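/- Let $\mathscr Y$ be a finite set and let $X^{(1)},X^{(2)},\dots$ be an irreducible homogeneous Markov chain with state space $\mathscr Y$ whose transition matrix $P$ has all rows equal to one probability vector $\pi=[p_j]_{j\in\mathscr Y}$ (in particular, an i.i.d. source with law $\pi$; otherwise only the law of $X^{(1)}$ may differ from $\pi$). Here irreducible means that there is no nonempty proper subset $A\subset\mathscr Y$ with $P_{A,A^c}=0$. Let $R$ be a finite ring with $1\neq 0$, not necessarily commutative, with $|R|\ge|\mathscr Y|$. Entropies are in bits; $H(\pi)$ is the entropy of $\pi$, and for a stochastic matrix $Q$ on $\mathscr Y$, with rows $Q_i$, $H(Q\mid\pi)=\sum_i p_iH(Q_i)$. For nonempty $A\subseteq\mathscr Y$ let $S_A=P_{A,A}+P_{A,A^c}(\mathbf 1-P_{A^c,A^c})^{-1}P_{A^c,A}$ be the stochastic complement of $P_{A,A}$ in $P$. For an injection $\Phi:\mathscr Y\to R$ and a left ideal $I$ of $R$ let $S_{\Phi,I}=\mathrm{diag}\{S_{\Phi^{-1}(A)}\}_{A\in R/I}$ (over cosets $A$ with $\Phi^{-1}(A)\ne\emptyset$), $Y^{(m)}_{R/I}=\Phi(X^{(m)})+I$,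 $\pi_{\Phi,I}=\big[\sum_{j\in\Phi^{-1}(A)}p_j\big]_{A\in R/I}$, and let $$r_\Phi=\max_{0\ne I\le_l R}\frac{\log|R|}{\log|I|}\min\Big\{H(S_{\Phi,I}\mid\pi),\ H(P\mid\pi)-\lim_{m\to\infty}\tfrac1m H\big(Y^{(m)}_{R/I},\dots,Y^{(1)}_{R/I}\big)\Big\},\qquad \mathcal R_\Phi=\{r\in\mathbb R: r>r_\Phi\},$$ the maximum being over the nonzero left ideals of $R$. Then for every injection $\Phi:\mathscr Y\to R$ the limits above exist, $$\mathcal R_\Phi=\Big\{r\in\mathbb R:\ r>\max_{0\neq I\le_l R}\frac{\log|R|}{\log|I|}\big[H(\pi)-H(\pi_{\Phi,I})\big]\Big\},$$ and $\mathcal R_\Phi$ is achievable with linear coding over $R$: for every $r\in\mathcal R_\Phi$ and $\varepsilon>0$ there is $N_0$ such that for every $n>N_0$ there are $k\ge 0$ with $k\log_2|R|\le nr$, a $k\times n$ matrix $A$ over $R$ and a decoder $\psi:R^k\to\mathscr Y^n$ with $$\Pr\Big\{\psi\big(A\,(\Phi(X^{(1)}),\dots,\Phi(X^{(n)}))^t\big)\ne(X^{(1)},\dots,X^{(n)})\Big\}<\varepsilon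 .$$ Moreover, if (1) $R$ is a field, or (2) $R$ has exactly one proper nonzero left ideal $I_0$, and $|I_0|=\sqrt{|R|}$, or (3) $R$ is isomorphic to a product of finitely many rings each satisfying (1) or (2), then $\bigcup_{\Phi}\mathcal R_\Phi$, the union over all injections $\Phi:\mathscr Y\to R$, is the Slepian–Wolf region $\{r\in\mathbb R: r>H(\pi)\}$. -/

import Mathlib

open MeasureTheory Filter Topology

/-- Shannon entropy, in bits, of a probability vector on a finite set. -/
noncomputable def entropy {α : Type*} [Fintype α] (p : α → ℝ) : ℝ :=
  ∑ a, -(p a * Real.logb 2 (p a))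

/-- `H(P | π)`: the entropy `H(Y | X)` when `X ∼ π` and, given `X = i`, `Y` has law the `i`-th row
of `P`. -/
noncomputable def condEntropy {α : Type*} [Fintype α] (P : Matrix α α ℝ) (π : α → ℝ) : ℝ :=
  ∑ i, π i * entropy (P i)

/-- A transition matrix is irreducible if no nonempty proper set `A` of states has
`P_{A, Aᶜ} = 0`. -/
def IrreducibleChain {α : Type*} (P : Matrix α α ℝ) : Prop :=
  ¬ ∃ A : Set α, A.Nonempty ∧ A ≠ Set.univ ∧ ∀ i ∈ A, ∀ j ∉ A, P i j = 0

/-- `X 0, X 1, …` (the data at times `1, 2, …`) is a homogeneous Markov chain with transition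
matrix `P`; the initial distribution is arbitrary. The conditional probabilities
`Pr(X (n+1) = x (n+1) | X n = x n, …, X 0 = x 0) = P (x n) (x (n+1))` are written multiplied out. -/
structure IsMarkovChain {Ω α : Type*} [MeasurableSpace Ω] [MeasurableSpace α] (μ : Measure Ω)
    (X : ℕ → Ω → α) (P : Matrix α α ℝ) : Prop where
  measurable : ∀ n, Measurable (X n)
  markov : ∀ (n : ℕ) (x : ℕ → α),
    μ.real {ω | ∀ i ≤ n + 1, X i ω = x i} =
      μ.real {ω | ∀ i ≤ n, X i ω = x i} * P (x n) (x (n + 1))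

open Classical in
/-- The stochastic complement of `P_{A, A}` in `P`:
`S_A = P_{A,A} + P_{A,Aᶜ} (1 - P_{Aᶜ,Aᶜ})⁻¹ P_{Aᶜ,A}`. -/
noncomputable def stochComplement {α : Type*} [Fintype α] (P : Matrix α α ℝ) (A : Set α) :
    Matrix A A ℝ :=
  P.submatrix (fun i : A => (i : α)) (fun j : A => (j : α)) +
    P.submatrix (fun i : A => (i : α)) (fun j : (Aᶜ : Set α) => (j : α)) *
      (1 - P.submatrix (fun i : (Aᶜ : Set α) => (i : α)) (fun j : (Aᶜ : Set α) => (j : α)))⁻¹ *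
      P.submatrix (fun i : (Aᶜ : Set α) => (i : α)) (fun j : A => (j : α))

open Classical in
/-- The block diagonal matrix whose blocks are the stochastic complements of `P` on the nonempty
fibres of `f`. -/
noncomputable def diagStochComplement {α κ : Type*} [Fintype α] (P : Matrix α α ℝ) (f : α → κ) :
    Matrix α α ℝ :=
  fun i j => if h : f j = f i then stochComplement P {y | f y = f i} ⟨i, rfl⟩ ⟨j, h⟩ else 0

/-- `(1/m) H(Z^{(1)}, …, Z^{(m)})`, the time `i + 1` datum being `Z i`. -/
noncomputable def blockEntropy {Ω κ : Type*} [MeasurableSpace Ω] [Fintype κ] (μ : Measure Ω)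
    (Z : ℕ → Ω → κ) (m : ℕ) : ℝ :=
  1 / (m : ℝ) * entropy (fun z : Fin m → κ => μ.real {ω | ∀ i : Fin m, Z i ω = z i})

/-- The entropy rate `lim_{m → ∞} (1/m) H(Z^{(1)}, …, Z^{(m)})`. -/
noncomputable def entropyRate {Ω κ : Type*} [MeasurableSpace Ω] [Fintype κ] (μ : Measure Ω)
    (Z : ℕ → Ω → κ) : ℝ :=
  limUnder atTop (blockEntropy μ Z)

/-- `y ↦ Φ(y) + I`, for a left ideal `I` (Mathlib's `Ideal R` is the type of left ideals). -/
def cosetMap {α R : Type*} [Ring R] (Φ : α ↪ R) (I : Ideal R) (y : α) : R ⧸ I :=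
  Submodule.Quotient.mk (Φ y)

open Classical in
/-- `π_{Φ, I}`: the probability vector on `R / I` with `A ↦ ∑_{y ∈ Φ⁻¹(A)} π y`. -/
noncomputable def cosetDist {α R : Type*} [Fintype α] [Ring R] (π : α → ℝ) (Φ : α ↪ R)
    (I : Ideal R) : R ⧸ I → ℝ :=
  fun A => ∑ y, if cosetMap Φ I y = A then π y else 0

/-- The threshold `r_Φ` for a Markov source `X` with transition matrix `P` and invariant
distribution `π`; for a nonzero finite ring the supremum is over a finite nonempty set, so it is a
maximum. -/
noncomputable def markovThreshold {Ω α R : Type*} [MeasurableSpace Ω] [Fintype α] [Ring R]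
    [Fintype R] (μ : Measure Ω) (X : ℕ → Ω → α) (P : Matrix α α ℝ) (π : α → ℝ) (Φ : α ↪ R) : ℝ :=
  ⨆ I : {I : Ideal R // I ≠ ⊥},
    Real.log (Nat.card R) / Real.log (Nat.card I.1) *
      min (condEntropy (diagStochComplement P (cosetMap Φ I.1)) π)
        (condEntropy P π - entropyRate μ (fun n ω => cosetMap Φ I.1 (X n ω)))

/-- The region `𝓡_Φ = {r | r > r_Φ}`. -/
def markovRegion {Ω α R : Type*} [MeasurableSpace Ω] [Fintype α] [Ring R]
    [Fintype R] (μ : Measure Ω) (X : ℕ → Ω → α) (P : Matrix α α ℝ) (π : α → ℝ) (Φ : α ↪ R) :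
    Set ℝ :=
  {r | r > markovThreshold μ X P π Φ}

/-- The rate `r` (in bits per symbol) is achievable for the source `X` with linear coding over `R`,
the source symbols being embedded in `R` by `Φ`: for every `ε > 0` and all large block lengths `n`,
there are a (left) linear encoder `x ↦ A x`, `R^n → R^k`, with at most `2 ^ (n r)` codewords in
`R^k`, and a decoder, with error probability less than `ε`. -/
def LinearlyAchievable {Ω α R : Type*} [MeasurableSpace Ω] [Ring R]
    (μ : Measure Ω) (X : ℕ → Ω → α) (Φ : α ↪ R) (r : ℝ) : Prop :=
  ∀ ε : ℝ, 0 < ε → ∃ N₀ : ℕ, ∀ n : ℕ, N₀ < n →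
    ∃ k : ℕ, (k : ℝ) * Real.logb 2 (Nat.card R) ≤ n * r ∧
      ∃ (A : Matrix (Fin k) (Fin n) R) (ψ : (Fin k → R) → (Fin n → α)),
        μ.real {ω | ψ (A.mulVec (fun i : Fin n => Φ (X i ω))) ≠ fun i : Fin n => X i ω} < ε

/-- `S` has exactly one proper nonzero left ideal, and it has order `√|S|`. -/
def HasUniqueSqrtIdeal (S : Type*) [Ring S] : Prop :=
  ∃ I₀ : Ideal S, (∀ I : Ideal S, (I ≠ ⊥ ∧ I ≠ ⊤) ↔ I = I₀) ∧
    (Nat.card I₀ : ℝ) = √(Nat.card S : ℝ)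

universe u

/-- `R` is (isomorphic to) a product of finitely many rings each of which is a field or has a
unique proper nonzero left ideal, of order the square root of the order of the ring. -/
def IsGoodProduct (R : Type u) [Ring R] : Prop :=
  ∃ (m : ℕ) (S : Fin m → Type u) (_ : ∀ i, Ring (S i)),
    (∀ i, IsField (S i) ∨ HasUniqueSqrtIdeal (S i)) ∧ Nonempty (R ≃+* ((i : Fin m) → S i))

/-!
Since all rows of `P` are `π`, the symbols of the source are independent, with law `π` from the
second one on, and irreducibility says that `π` has no zero. Hence the entropy rate of the coset
process is `H(π_{Φ,I})` (`tendsto_blockEntropy`). The stochastic complement on a fibre has the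
conditional law of `π` on that fibre for its rows (`stochComplement_apply`), so both terms of the
minimum equal `H(π) - H(π_{Φ,I})` (`markovThreshold_eq`).

Achievability (`linearlyAchievable_of_forall_lt`) is by random coding. A uniformly random matrix
with `k` rows identifies two fixed words with probability `|I|⁻ᵏ`, where `I` is the left ideal
generated by their differences. The decoder looks for a word whose conditional information given its
cosets modulo `I` is at most `n (H(π) - H(π_{Φ,I}) + δ)`, for every `I ≠ 0`. By Chebyshev's
inequality a source word nearly always has this property, and at most
`2 ^ (n (H(π) - H(π_{Φ,I}) + δ))` words with the property agree with a given one modulo `I`.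

For the union, the ideal `I = R` gives `r_Φ ≥ H(π)`. Conversely, one injection `Φ` is needed for
which every left ideal satisfies `H(π_{Φ,I}) ≥ (log |R / I| / log |R|) H(π)`. In a product of rings
`S i` whose left ideals are `0`, `J i` and `S i`, choose coordinates in `S i / J i` and in `J i`;
congruence modulo a left ideal means that certain of these coordinates agree
(`IsGoodProduct.exists_coordinates`). So it suffices to arrange a law on a box of given side lengths
in such a way that every set of coordinates carries at least its share of the entropy, the shares
being proportional to the logarithms of the side lengths (`exists_arrangement`).

The arrangement is built by splitting a label with values in `A × B` into its two coordinates, one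
splitting at a time. A random relabelling of `A × B` before the splitting leaves the first
coordinate, on average and jointly with any label already present, with at least its share
`log |A| / log |A × B|` of the entropy (`sum_labelEntropy_perm_ge`). That average bound reduces, by
removing one point at a time, to the inequality `sum_gap_nonneg` for a single law, and the latter to
a function of one variable. Averages control each set of coordinates separately. To treat all sets
at once, suppose that each relabelling `σ` fails at some set `U σ`. Entropy is submodular
(`labelEntropy_submodular`), and uncrossing the family `U σ` against its quantile set `V` (the
coordinates that lie in a suitable fraction of the `U σ`) contradicts the average bound at `V`
(`exists_perm_fst`). Finally, submodularity shows that a relabelling is good for at least one of the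
two coordinates, and goodness for either one is unaffected by transpositions that change only the
other; as these generate all permutations, some relabelling is good for both (`exists_perm_both`).
-/

/-! ### Entropy of a label -/

open Classical in
/-- The mass, under `p`, of the fibre of `f` through `x`. -/
noncomputable def fiberMass {E κ : Type*} [Fintype E] (p : E → ℝ) (f : E → κ) (x : E) : ℝ :=
  ∑ y with f y = f x, p y

/-- The entropy, in nats, of the label `f x` of a random point `x` with law `p`. It is written as a
sum over points rather than over labels, so that the type of labels need not be finite and the
value visibly depends only on the partition into fibres. -/
noncomputable def labelEntropy {E κ : Type*} [Fintype E] (p : E → ℝ) (f : E → κ) : ℝ :=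
  ∑ x, p x * -Real.log (fiberMass p f x)

section Label

variable {E κ κ₁ κ₂ κ₃ κ₄ : Type*} [Fintype E] {p : E → ℝ}

lemma fiberMass_congr (f : E → κ₁) (g : E → κ₂) (x x' : E)
    (h : ∀ y, f y = f x ↔ g y = g x') : fiberMass p f x = fiberMass p g x' := by
  classical
  unfold fiberMass
  congr 1
  ext y
  simp [h y]

lemma labelEntropy_congr (f : E → κ₁) (g : E → κ₂) (h : ∀ x y, f x = f y ↔ g x = g y) :
    labelEntropy p f = labelEntropy p g := by
  unfold labelEntropy
  refine Finset.sum_congr rfl fun x _ => ?_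
  rw [fiberMass_congr f g x x fun y => h y x]

lemma fiberMass_nonneg (hp : ∀ x, 0 ≤ p x) (f : E → κ) (x : E) : 0 ≤ fiberMass p f x :=
  Finset.sum_nonneg fun _ _ => hp _

lemma le_fiberMass (hp : ∀ x, 0 ≤ p x) (f : E → κ) (x : E) : p x ≤ fiberMass p f x := by
  classical
  exact Finset.single_le_sum (f := p) (fun _ _ => hp _) (by simp)

lemma labelEntropy_of_injective (f : E → κ) (hf : Function.Injective f) :
    labelEntropy p f = ∑ x, Real.negMulLog (p x) := by
  classical
  unfold labelEntropy
  refine Finset.sum_congr rfl fun x _ => ?_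
  have : fiberMass p f x = p x := by
    unfold fiberMass
    rw [show Finset.univ.filter (fun y => f y = f x) = {x} by ext y; simp [hf.eq_iff],
      Finset.sum_singleton]
  rw [this, Real.negMulLog]; ring

lemma labelEntropy_const (hp1 : ∑ x, p x = 1) (f : E → κ) (hf : ∀ x y, f x = f y) :
    labelEntropy p f = 0 := by
  classical
  unfold labelEntropy
  refine Finset.sum_eq_zero fun x _ => ?_
  have : fiberMass p f x = 1 := by
    unfold fiberMass
    rw [Finset.filter_true_of_mem fun y _ => hf y x, hp1]
  simp [this]

/-- Submodularity of entropy: if the label `k` is a function of `f` and of `g`, and the label `j` is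
a function of the pair `(f, g)`, then `H(j) + H(k) ≤ H(f) + H(g)`. -/
lemma labelEntropy_submodular (hp : ∀ x, 0 ≤ p x) (f : E → κ₁) (g : E → κ₂) (j : E → κ₃)
    (k : E → κ₄) (hkf : ∀ x y, f x = f y → k x = k y) (hkg : ∀ x y, g x = g y → k x = k y)
    (hj : ∀ x y, f x = f y → g x = g y → j x = j y) :
    labelEntropy p j + labelEntropy p k ≤ labelEntropy p f + labelEntropy p g := by
  classical
  -- `log z ≤ z - 1` reduces the claim to a bound on a sum of ratios of fibre masses
  have key : ∑ x, p x * (fiberMass p f x * fiberMass p g x /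
      (fiberMass p j x * fiberMass p k x)) ≤ ∑ x, p x := by
    have hinner : ∀ y z, (∑ x, if f y = f x ∧ g z = g x then
        p x / (fiberMass p j x * fiberMass p k x) else 0) ≤
        if k z = k y then 1 / fiberMass p k y else 0 := by
      intro y z
      rw [← Finset.sum_filter]
      by_cases hne : ∃ x, f y = f x ∧ g z = g x
      · obtain ⟨x₀, h1, h2⟩ := hne
        have hk : k z = k y := by rw [hkg _ _ h2, hkf _ _ h1]
        rw [if_pos hk]
        have hterm : ∀ x ∈ Finset.univ.filter (fun x => f y = f x ∧ g z = g x),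
            p x / (fiberMass p j x * fiberMass p k x) =
              p x * (1 / (fiberMass p j x₀ * fiberMass p k y)) := by
          intro x hx
          simp only [Finset.mem_filter, Finset.mem_univ, true_and] at hx
          have e1 : fiberMass p j x = fiberMass p j x₀ := by
            apply fiberMass_congr
            intro w
            rw [hj x x₀ (by rw [← hx.1, h1]) (by rw [← hx.2, h2])]
          have e2 : fiberMass p k x = fiberMass p k y := by
            apply fiberMass_congr
            intro w
            rw [hkf y x hx.1]
          rw [e1, e2]; ring
        rw [Finset.sum_congr rfl hterm, ← Finset.sum_mul]
        have hle : ∑ x with f y = f x ∧ g z = g x, p x ≤ fiberMass p j x₀ := by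
          unfold fiberMass
          refine Finset.sum_le_sum_of_subset_of_nonneg ?_ fun _ _ _ => hp _
          intro x hx
          simp only [Finset.mem_filter, Finset.mem_univ, true_and] at hx ⊢
          exact hj x x₀ (by rw [← hx.1, h1]) (by rw [← hx.2, h2])
        have hk0 := fiberMass_nonneg hp k y
        have hj0 := fiberMass_nonneg hp j x₀
        calc _ ≤ fiberMass p j x₀ * (1 / (fiberMass p j x₀ * fiberMass p k y)) := by gcongr
          _ = (fiberMass p j x₀ / fiberMass p j x₀) * (1 / fiberMass p k y) := by
              rw [one_div, mul_inv]; ring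
          _ ≤ 1 * (1 / fiberMass p k y) := by
              gcongr; exact div_self_le_one _
          _ = _ := one_mul _
      · have : Finset.univ.filter (fun x => f y = f x ∧ g z = g x) = ∅ := by
          ext x; simp only [Finset.mem_filter, Finset.mem_univ, true_and, Finset.notMem_empty,
            iff_false]
          exact fun h => hne ⟨x, h⟩
        rw [this, Finset.sum_empty]
        split_ifs
        · exact one_div_nonneg.2 (fiberMass_nonneg hp k y)
        · exact le_rfl
    calc ∑ x, p x * (fiberMass p f x * fiberMass p g x / (fiberMass p j x * fiberMass p k x))
        = ∑ x, ∑ y, ∑ z, p y * (p z * (if f y = f x ∧ g z = g x then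
            p x / (fiberMass p j x * fiberMass p k x) else 0)) := by
          refine Finset.sum_congr rfl fun x _ => ?_
          have e1 : fiberMass p f x = ∑ y, if f y = f x then p y else 0 := by
            unfold fiberMass; rw [Finset.sum_filter]
          have e2 : fiberMass p g x = ∑ z, if g z = g x then p z else 0 := by
            unfold fiberMass; rw [Finset.sum_filter]
          rw [show p x * (fiberMass p f x * fiberMass p g x /
            (fiberMass p j x * fiberMass p k x)) = fiberMass p f x * fiberMass p g x *
            (p x / (fiberMass p j x * fiberMass p k x)) by ring]
          set c := p x / (fiberMass p j x * fiberMass p k x)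
          rw [e1, e2, Finset.sum_mul_sum, Finset.sum_mul]
          refine Finset.sum_congr rfl fun y _ => ?_
          rw [Finset.sum_mul]
          refine Finset.sum_congr rfl fun z _ => ?_
          by_cases h1 : f y = f x <;> by_cases h2 : g z = g x <;> simp [h1, h2, mul_assoc]
      _ = ∑ y, ∑ z, p y * (p z * ∑ x, (if f y = f x ∧ g z = g x then
            p x / (fiberMass p j x * fiberMass p k x) else 0)) := by
          rw [Finset.sum_comm]
          refine Finset.sum_congr rfl fun y _ => ?_
          rw [Finset.sum_comm]
          refine Finset.sum_congr rfl fun z _ => ?_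
          rw [Finset.mul_sum, Finset.mul_sum]
      _ ≤ ∑ y, ∑ z, p y * (p z * if k z = k y then 1 / fiberMass p k y else 0) := by
          refine Finset.sum_le_sum fun y _ => Finset.sum_le_sum fun z _ => ?_
          exact mul_le_mul_of_nonneg_left (mul_le_mul_of_nonneg_left (hinner y z) (hp z)) (hp y)
      _ = ∑ y, p y * (fiberMass p k y / fiberMass p k y) := by
          refine Finset.sum_congr rfl fun y _ => ?_
          rw [← Finset.mul_sum]
          congr 1
          conv_rhs => rw [div_eq_mul_one_div]; enter [1]; unfold fiberMass
          rw [Finset.sum_mul, Finset.sum_filter]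
          refine Finset.sum_congr rfl fun z _ => ?_
          split_ifs <;> simp
      _ ≤ ∑ y, p y := by
          refine Finset.sum_le_sum fun y _ => ?_
          exact mul_le_of_le_one_right (hp y) (div_self_le_one _)
  have hpt : ∀ x, p x * (Real.log (fiberMass p f x) + Real.log (fiberMass p g x) -
      Real.log (fiberMass p j x) - Real.log (fiberMass p k x)) ≤
      p x * (fiberMass p f x * fiberMass p g x / (fiberMass p j x * fiberMass p k x)) - p x := by
    intro x
    rcases (hp x).eq_or_lt with h0 | hpos
    · simp [← h0]
    · have h1 := hpos.trans_le (le_fiberMass hp f x)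
      have h2 := hpos.trans_le (le_fiberMass hp g x)
      have h3 := hpos.trans_le (le_fiberMass hp j x)
      have h4 := hpos.trans_le (le_fiberMass hp k x)
      have h5 := Real.log_le_sub_one_of_pos (div_pos (mul_pos h1 h2) (mul_pos h3 h4))
      rw [Real.log_div (by positivity) (by positivity), Real.log_mul h1.ne' h2.ne',
        Real.log_mul h3.ne' h4.ne'] at h5
      nlinarith
  have hsum := Finset.sum_le_sum fun x (_ : x ∈ Finset.univ) => hpt x
  rw [Finset.sum_sub_distrib] at hsum
  have : ∑ x, p x * (Real.log (fiberMass p f x) + Real.log (fiberMass p g x) -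
      Real.log (fiberMass p j x) - Real.log (fiberMass p k x)) =
      (labelEntropy p j + labelEntropy p k) - (labelEntropy p f + labelEntropy p g) := by
    unfold labelEntropy
    rw [← Finset.sum_add_distrib, ← Finset.sum_add_distrib, ← Finset.sum_sub_distrib]
    exact Finset.sum_congr rfl fun x _ => by ring
  linarith

end Label

/-! ### Uncrossing submodular functions -/

section Uncrossing

variable {ι J : Type*} [DecidableEq ι]

/-- Uncrossing: replacing a family of sets by the chain of its threshold sets (the points covered at
least once, at least twice, …) does not increase the sum of a submodular function. -/
lemma sum_thresholds_le (f : Finset ι → ℝ)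
    (hf : ∀ S T, f (S ∪ T) + f (S ∩ T) ≤ f S + f T) (V : Finset ι) (U : J → Finset ι)
    (s : Finset J) (hU : ∀ σ ∈ s, U σ ⊆ V) :
    ∑ j ∈ Finset.range s.card, f {i ∈ V | j + 1 ≤ (s.filter fun σ => i ∈ U σ).card} ≤
      ∑ σ ∈ s, f (U σ) := by
  classical
  induction s using Finset.induction_on with
  | empty => simp
  | insert a s ha ih =>
    have ih' := ih fun σ hσ => hU σ (Finset.mem_insert_of_mem hσ)
    have hUa := hU a (Finset.mem_insert_self _ _)
    let W : ℕ → Finset ι := fun j => {i ∈ V | j ≤ (s.filter fun σ => i ∈ U σ).card}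
    let W' : ℕ → Finset ι := fun j => {i ∈ V | j ≤ ((insert a s).filter fun σ => i ∈ U σ).card}
    have hcard : ∀ i, ((insert a s).filter fun σ => i ∈ U σ).card =
        (s.filter fun σ => i ∈ U σ).card + if i ∈ U a then 1 else 0 := by
      intro i
      rw [Finset.filter_insert]
      split_ifs with h
      · rw [Finset.card_insert_of_notMem (by simp [ha])]
      · rfl
    have hW' : ∀ j, W' (j + 1) = W (j + 1) ∪ (W j ∩ U a) := by
      intro j
      ext i
      have := hcard i
      simp only [W, W', Finset.mem_filter, Finset.mem_union, Finset.mem_inter]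
      by_cases h : i ∈ U a
      · rw [this]; simp only [h, if_true, and_true]; constructor
        · rintro ⟨h1, h2⟩; right; exact ⟨h1, by omega⟩
        · rintro (⟨h1, h2⟩ | ⟨h1, h2⟩) <;> exact ⟨h1, by omega⟩
      · rw [this]; simp [h]
    have hstep : ∀ r, ∑ j ∈ Finset.range r, f (W' (j + 1)) + f (W r ∩ U a) ≤
        f (U a) + ∑ j ∈ Finset.range r, f (W (j + 1)) := by
      intro r
      induction r with
      | zero =>
        have : W 0 ∩ U a = U a := by
          ext i; simp only [W, Finset.mem_inter, Finset.mem_filter, Nat.zero_le, and_true]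
          exact ⟨fun h => h.2, fun h => ⟨hUa h, h⟩⟩
        simp [this]
      | succ r ihr =>
        rw [Finset.sum_range_succ, Finset.sum_range_succ, hW' r]
        have h1 := hf (W (r + 1)) (W r ∩ U a)
        have h2 : W (r + 1) ∩ (W r ∩ U a) = W (r + 1) ∩ U a := by
          ext i; simp only [W, Finset.mem_inter, Finset.mem_filter]
          constructor
          · rintro ⟨h1, h2, h3⟩; exact ⟨h1, h3⟩
          · rintro ⟨h1, h3⟩; exact ⟨h1, ⟨h1.1, by omega⟩, h3⟩
        rw [h2] at h1
        linarith
    rw [Finset.card_insert_of_notMem ha, Finset.sum_range_succ, Finset.sum_insert ha]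
    have hlast : W' (s.card + 1) = W s.card ∩ U a := by
      rw [hW']
      have : W (s.card + 1) = ∅ := by
        ext i; simp only [W, Finset.mem_filter, Finset.notMem_empty, iff_false, not_and]
        intro _ h
        have := Finset.card_filter_le s (fun σ => i ∈ U σ)
        omega
      rw [this, Finset.empty_union]
    have := hstep s.card
    change ∑ j ∈ Finset.range s.card, f (W' (j + 1)) + f (W' (s.card + 1)) ≤ _
    rw [hlast]
    change ∑ j ∈ Finset.range s.card, f (W (j + 1)) ≤ _ at ih'
    linarith

/-- If every point of `V` is covered at least `j` times by subsets of `V`, a nonnegative submodular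
function has sum at least `j * f V` over these subsets. -/
lemma mul_le_sum_of_cover (f : Finset ι → ℝ)
    (hf : ∀ S T, f (S ∪ T) + f (S ∩ T) ≤ f S + f T) (V : Finset ι) (hf0 : ∀ S ⊆ V, 0 ≤ f S)
    (U : J → Finset ι) (s : Finset J) (hU : ∀ σ ∈ s, U σ ⊆ V) (j : ℕ) (hj : j ≤ s.card)
    (hcov : ∀ i ∈ V, j ≤ (s.filter fun σ => i ∈ U σ).card) :
    j * f V ≤ ∑ σ ∈ s, f (U σ) := by
  refine le_trans ?_ (sum_thresholds_le f hf V U s hU)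
  obtain ⟨m, hm⟩ := Nat.exists_eq_add_of_le hj
  rw [hm, Finset.sum_range_add]
  have h1 : ∑ x ∈ Finset.range j, f {i ∈ V | x + 1 ≤ (s.filter fun σ => i ∈ U σ).card} =
      j * f V := by
    rw [Finset.sum_congr rfl (g := fun _ => f V)]
    · simp
    · intro x hx
      rw [Finset.mem_range] at hx
      rw [Finset.filter_true_of_mem]
      intro i hi
      have := hcov i hi
      omega
  rw [h1]
  exact le_add_of_nonneg_right (Finset.sum_nonneg fun x _ => hf0 _ (Finset.filter_subset _ _))

/-- The dual of `mul_le_sum_of_cover`, for unions with `V` instead of intersections. -/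
lemma mul_le_sum_union (f : Finset ι → ℝ)
    (hf : ∀ S T, f (S ∪ T) + f (S ∩ T) ≤ f S + f T) (F V : Finset ι) (hVF : V ⊆ F)
    (hf0 : ∀ S ⊆ F, 0 ≤ f S)
    (U : J → Finset ι) (s : Finset J) (hU : ∀ σ ∈ s, U σ ⊆ F) (j : ℕ) (hj : j ≤ s.card)
    (hcov : ∀ i ∈ F \ V, j ≤ (s.filter fun σ => i ∉ U σ).card) :
    j * f V ≤ ∑ σ ∈ s, f (U σ ∪ V) := by
  have h := mul_le_sum_of_cover (fun S => f (F \ S))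
    (fun S T => by
      have e1 : F \ (S ∪ T) = (F \ S) ∩ (F \ T) := Finset.sdiff_union_distrib _ _ _
      have e2 : F \ (S ∩ T) = (F \ S) ∪ (F \ T) := by
        ext i; simp only [Finset.mem_sdiff, Finset.mem_inter, Finset.mem_union]; tauto
      have := hf (F \ S) (F \ T)
      simp only [e1, e2]
      linarith)
    (F \ V) (fun S _ => hf0 _ Finset.sdiff_subset) (fun σ => (F \ V) \ U σ) s
    (fun σ _ => Finset.sdiff_subset) j hj
    (fun i hi => by
      refine (hcov i hi).trans (Finset.card_le_card ?_)
      intro σ hσ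
      simp only [Finset.mem_filter] at hσ ⊢
      exact ⟨hσ.1, Finset.mem_sdiff.2 ⟨hi, hσ.2⟩⟩)
  simp only [Finset.sdiff_sdiff_eq_self hVF] at h
  refine h.trans (le_of_eq (Finset.sum_congr rfl fun σ hσ => ?_))
  congr 1
  ext i
  have := @hU σ hσ i
  have := @hVF i
  simp only [Finset.mem_sdiff, Finset.mem_union]
  tauto

end Uncrossing

/-! ### Removing one point: an entropy inequality -/

/-- The function whose sum over the coordinates of a probability vector is to be shown nonnegative
in `sum_gap_nonneg`. -/
noncomputable def gapFun (κ x : ℝ) : ℝ := Real.negMulLog (1 - x) - κ * Real.negMulLog x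

lemma gapFun_zero (κ : ℝ) : gapFun κ 0 = 0 := by simp [gapFun]
lemma gapFun_one (κ : ℝ) : gapFun κ 1 = 0 := by simp [gapFun]

lemma continuous_gapFun (κ : ℝ) : Continuous (gapFun κ) := by
  unfold gapFun
  exact (Real.continuous_negMulLog.comp (continuous_const.sub continuous_id)).sub
    (continuous_const.mul Real.continuous_negMulLog)

lemma hasDerivAt_gapFun (κ : ℝ) {x : ℝ} (h0 : x ≠ 0) (h1 : x ≠ 1) :
    HasDerivAt (gapFun κ) (Real.log (1 - x) + 1 + κ * (Real.log x + 1)) x := by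
  have h2 : (1 : ℝ) - x ≠ 0 := sub_ne_zero.2 h1.symm
  have ha := (Real.hasDerivAt_negMulLog h2).comp x ((hasDerivAt_id x).const_sub 1)
  have hb := (Real.hasDerivAt_negMulLog h0).const_mul κ
  refine (ha.sub hb).congr_deriv ?_
  ring

lemma hasDerivAt_deriv_gapFun (κ : ℝ) {x : ℝ} (h0 : x ≠ 0) (h1 : x ≠ 1) :
    HasDerivAt (fun x => Real.log (1 - x) + 1 + κ * (Real.log x + 1)) (κ / x - 1 / (1 - x)) x := by
  have h2 : (1 : ℝ) - x ≠ 0 := sub_ne_zero.2 h1.symm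
  have ha := (((hasDerivAt_id x).const_sub 1).log h2).add_const 1
  have hb := ((Real.hasDerivAt_log h0).add_const 1).const_mul κ
  refine (ha.add hb).congr_deriv ?_
  simp only [id]
  ring

lemma deriv2_gapFun (κ : ℝ) {x : ℝ} (h0 : 0 < x) (h1 : x < 1) :
    deriv^[2] (gapFun κ) x = κ / x - 1 / (1 - x) := by
  simp only [Function.iterate_succ, Function.iterate_zero, Function.comp, id]
  have : deriv (gapFun κ) =ᶠ[𝓝 x] fun x => Real.log (1 - x) + 1 + κ * (Real.log x + 1) := by
    filter_upwards [Ioo_mem_nhds h0 h1] with y hy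
    exact (hasDerivAt_gapFun κ hy.1.ne' hy.2.ne).deriv
  rw [this.deriv_eq]
  exact (hasDerivAt_deriv_gapFun κ h0.ne' h1.ne).deriv

lemma strictConvexOn_gapFun {κ : ℝ} (hκ : 0 < κ) :
    StrictConvexOn ℝ (Set.Icc 0 (κ / (1 + κ))) (gapFun κ) := by
  refine strictConvexOn_of_deriv2_pos (convex_Icc _ _) (continuous_gapFun κ).continuousOn ?_
  intro x hx
  rw [interior_Icc] at hx
  have hx1 : x * (1 + κ) < κ := (lt_div_iff₀ (by linarith)).1 hx.2
  have h1 : x < 1 := by nlinarith [hx.1]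
  rw [deriv2_gapFun κ hx.1 h1, sub_pos, div_lt_div_iff₀ (by linarith) hx.1]
  linarith

lemma strictConcaveOn_gapFun {κ : ℝ} (hκ : 0 < κ) :
    StrictConcaveOn ℝ (Set.Icc (κ / (1 + κ)) 1) (gapFun κ) := by
  refine strictConcaveOn_of_deriv2_neg (convex_Icc _ _) (continuous_gapFun κ).continuousOn ?_
  intro x hx
  rw [interior_Icc] at hx
  have hx1 : κ < x * (1 + κ) := (div_lt_iff₀ (by linarith)).1 hx.1
  have h0 : 0 < x := lt_trans (by positivity) hx.1
  rw [deriv2_gapFun κ h0 hx.2, sub_neg, div_lt_div_iff₀ h0 (by linarith [hx.2])]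
  linarith

/-- `gapFun` summed over a probability vector on `N + 1` points that has one coordinate `t` and `N`
equal ones. -/
noncomputable def gapSum (N κ t : ℝ) : ℝ := gapFun κ t + N * gapFun κ ((1 - t) / N)

lemma hasDerivAt_gapSum {N : ℝ} (κ : ℝ) (hN : 1 ≤ N) {t : ℝ} (h0 : 0 < t) (h1 : t < 1) :
    HasDerivAt (gapSum N κ) ((Real.log (1 - t) + 1 + κ * (Real.log t + 1)) -
      (Real.log (1 - (1 - t) / N) + 1 + κ * (Real.log ((1 - t) / N) + 1))) t := by
  have hN0 : 0 < N := by linarith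
  have hr0 : (1 - t) / N ≠ 0 := (div_pos (by linarith) hN0).ne'
  have hr1 : (1 - t) / N ≠ 1 := ((div_lt_one hN0).2 (by linarith)).ne
  have hr : HasDerivAt (fun t : ℝ => (1 - t) / N) (-1 / N) t :=
    ((hasDerivAt_id t).const_sub 1).div_const N
  have ha := hasDerivAt_gapFun κ h0.ne' h1.ne
  have hb := ((hasDerivAt_gapFun κ hr0 hr1).comp t hr).const_mul N
  refine (ha.add hb).congr_deriv ?_
  field_simp
  ring

lemma hasDerivAt_deriv_gapSum {N : ℝ} (κ : ℝ) (hN : 1 ≤ N) {t : ℝ} (h0 : 0 < t) (h1 : t < 1) :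
    HasDerivAt (fun t => (Real.log (1 - t) + 1 + κ * (Real.log t + 1)) -
      (Real.log (1 - (1 - t) / N) + 1 + κ * (Real.log ((1 - t) / N) + 1)))
      ((κ * (N - 1 + t) - N * t) / (t * (1 - t) * (N - 1 + t))) t := by
  have hN0 : 0 < N := by linarith
  have hr0 : (1 - t) / N ≠ 0 := (div_pos (by linarith) hN0).ne'
  have hr1 : (1 - t) / N < 1 := (div_lt_one hN0).2 (by linarith)
  have hr : HasDerivAt (fun t : ℝ => (1 - t) / N) (-1 / N) t :=
    ((hasDerivAt_id t).const_sub 1).div_const N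
  have ha := hasDerivAt_deriv_gapFun κ h0.ne' h1.ne
  have hb := (hasDerivAt_deriv_gapFun κ hr0 hr1.ne).comp t hr
  refine (ha.sub hb).congr_deriv ?_
  have e1 : (1 : ℝ) - t ≠ 0 := by linarith
  have e2 : N - 1 + t ≠ 0 := by linarith
  have e3 : 1 - (1 - t) / N = (N - 1 + t) / N := by field_simp; ring
  rw [e3]
  field_simp
  ring

lemma continuous_gapSum (N κ : ℝ) : Continuous (gapSum N κ) := by
  unfold gapSum
  exact (continuous_gapFun κ).add (continuous_const.mul
    ((continuous_gapFun κ).comp ((continuous_const.sub continuous_id).div_const N)))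

/-- The two-valued case: as `t` runs from `1 / (N + 1)` to `1`, the function `gapSum` is first
convex and then concave; it vanishes at both ends and is stationary at the first. -/
lemma gapSum_nonneg {N κ : ℝ} (hN : 1 ≤ N)
    (hκ : κ * Real.log (N + 1) = N * (Real.log (N + 1) - Real.log N)) {t : ℝ}
    (ht : t ∈ Set.Icc (1 / (N + 1)) 1) : 0 ≤ gapSum N κ t := by
  have hN0 : 0 < N := by linarith
  have hlog1 : 0 < Real.log (N + 1) := Real.log_pos (by linarith)
  have hκN : κ ≤ N := by
    have h := Real.log_nonneg hN
    by_contra hlt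
    nlinarith
  have hs0 : (0 : ℝ) < 1 / (N + 1) := by positivity
  have hs1 : 1 / (N + 1) < 1 := (div_lt_one (by linarith)).2 (by linarith)
  have hrs : (1 - 1 / (N + 1)) / N = 1 / (N + 1) := by field_simp; ring
  have hfs : gapSum N κ (1 / (N + 1)) = 0 := by
    have : gapFun κ (1 / (N + 1)) = 0 := by
      unfold gapFun Real.negMulLog
      rw [show 1 - 1 / (N + 1) = N / (N + 1) by field_simp; ring,
        Real.log_div hN0.ne' (by linarith), Real.log_div one_ne_zero (by linarith), Real.log_one]
      field_simp
      linarith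
    rw [gapSum, hrs, this]; simp
  have hf1 : gapSum N κ 1 = 0 := by simp [gapSum, gapFun_one, gapFun_zero]
  obtain ⟨m, hm, hmin⟩ := isCompact_Icc.exists_isMinOn (s := Set.Icc (1 / (N + 1)) 1) ⟨t, ht⟩
    (continuous_gapSum N κ).continuousOn
  refine le_trans ?_ (hmin ht)
  by_contra! hneg
  have hm0 : 1 / (N + 1) < m := lt_of_le_of_ne hm.1 fun h => by rw [← h, hfs] at hneg; simp at hneg
  have hm1 : m < 1 := lt_of_le_of_ne hm.2 fun h => by rw [h, hf1] at hneg; simp at hneg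
  have hmpos : 0 < m := hs0.trans hm0
  rcases le_or_gt 0 (κ * (N - 1 + m) - N * m) with hsign | hsign
  · -- convex to the left of `m`
    have hconv : ConvexOn ℝ (Set.Icc (1 / (N + 1)) m) (gapSum N κ) := by
      refine convexOn_of_hasDerivWithinAt2_nonneg (convex_Icc _ _)
        (continuous_gapSum N κ).continuousOn
        (fun x hx => ?_) (fun x hx => ?_) (f'' := fun t =>
          (κ * (N - 1 + t) - N * t) / (t * (1 - t) * (N - 1 + t))) (fun x hx => ?_)
        (f' := fun t => (Real.log (1 - t) + 1 + κ * (Real.log t + 1)) -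
          (Real.log (1 - (1 - t) / N) + 1 + κ * (Real.log ((1 - t) / N) + 1)))
      all_goals rw [interior_Icc] at hx
      · exact (hasDerivAt_gapSum κ hN (hs0.trans hx.1) (hx.2.trans hm1)).hasDerivWithinAt
      · exact (hasDerivAt_deriv_gapSum κ hN (hs0.trans hx.1) (hx.2.trans hm1)).hasDerivWithinAt
      · have h1 := hs0.trans hx.1
        have h2 := hx.2.trans hm1
        refine div_nonneg ?_ (mul_nonneg (mul_nonneg h1.le (by linarith)) (by linarith))
        nlinarith [hx.2]
    have hd := hasDerivAt_gapSum κ hN hs0 hs1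
    rw [hrs, sub_self] at hd
    have h := hconv.le_slope_of_hasDerivAt (Set.left_mem_Icc.2 hm0.le) (Set.right_mem_Icc.2 hm0.le)
      hm0 hd
    rw [slope_def_field, hfs, sub_zero, le_div_iff₀ (by linarith), zero_mul] at h
    linarith
  · -- concave to the right of `m`, where the derivative vanishes
    have hconc : ConcaveOn ℝ (Set.Icc m 1) (gapSum N κ) := by
      refine concaveOn_of_hasDerivWithinAt2_nonpos (convex_Icc _ _)
        (continuous_gapSum N κ).continuousOn
        (fun x hx => ?_) (fun x hx => ?_) (f'' := fun t =>
          (κ * (N - 1 + t) - N * t) / (t * (1 - t) * (N - 1 + t))) (fun x hx => ?_)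
        (f' := fun t => (Real.log (1 - t) + 1 + κ * (Real.log t + 1)) -
          (Real.log (1 - (1 - t) / N) + 1 + κ * (Real.log ((1 - t) / N) + 1)))
      all_goals rw [interior_Icc] at hx
      · exact (hasDerivAt_gapSum κ hN (hmpos.trans hx.1) hx.2).hasDerivWithinAt
      · exact (hasDerivAt_deriv_gapSum κ hN (hmpos.trans hx.1) hx.2).hasDerivWithinAt
      · have h1 := hmpos.trans hx.1
        refine div_nonpos_of_nonpos_of_nonneg ?_
          (mul_nonneg (mul_nonneg h1.le (by linarith [hx.2])) (by linarith))
        nlinarith [hx.1]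
    have hd := hasDerivAt_gapSum κ hN hmpos hm1
    have hloc : IsLocalMin (gapSum N κ) m :=
      hmin.isLocalMin (Icc_mem_nhds hm0 hm1)
    have hz := hloc.hasDerivAt_eq_zero hd
    rw [hz] at hd
    have h := hconc.slope_le_of_hasDerivAt (Set.left_mem_Icc.2 hm1.le) (Set.right_mem_Icc.2 hm1.le)
      hm1 hd
    rw [slope_def_field, hf1, div_le_iff₀ (by linarith), zero_mul] at h
    linarith

/-- For a probability vector `p` on `n ≥ 2` points, `∑ η(1 - pᵢ) ≥ κ ∑ η(pᵢ)` with
`η x = - x log x`, where `κ` is such that the uniform vector gives equality; the point masses also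
give equality. At a minimum of the difference at most one coordinate can lie in the region where
`gapFun κ` is concave, and the others are equal. -/
lemma sum_gap_nonneg {ι : Type*} [Fintype ι] (hcard : 2 ≤ Fintype.card ι) {κ : ℝ} (hκ0 : 0 < κ)
    (hκ : κ * Real.log (Fintype.card ι) = (Fintype.card ι - 1) *
      (Real.log (Fintype.card ι) - Real.log ((Fintype.card ι : ℝ) - 1)))
    (p : ι → ℝ) (hp : p ∈ stdSimplex ℝ ι) : 0 ≤ ∑ i, gapFun κ (p i) := by
  classical
  set n : ℝ := (Fintype.card ι : ℝ) with hn
  have hn2 : (2 : ℝ) ≤ n := by rw [hn]; exact_mod_cast hcard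
  have hG : Continuous fun q : ι → ℝ => ∑ i, gapFun κ (q i) :=
    continuous_finsetSum _ fun i _ => (continuous_gapFun κ).comp (continuous_apply i)
  obtain ⟨q, hq, hmin⟩ := (isCompact_stdSimplex ℝ ι).exists_isMinOn ⟨p, hp⟩ hG.continuousOn
  refine le_trans ?_ (hmin hp)
  have hq0 : ∀ i, 0 ≤ q i := hq.1
  have hq1 : ∑ i, q i = 1 := hq.2
  have hsplit : ∀ (f : ι → ℝ) (i j : ι), i ≠ j →
      ∑ k, f k = f i + (f j + ∑ k ∈ (Finset.univ.erase i).erase j, f k) := by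
    intro f i j hij
    rw [Finset.add_sum_erase _ f (Finset.mem_erase.2 ⟨hij.symm, Finset.mem_univ _⟩),
      Finset.add_sum_erase _ f (Finset.mem_univ _)]
  have hpert : ∀ i j, i ≠ j → ∀ a b, 0 ≤ a → 0 ≤ b → a + b = q i + q j →
      gapFun κ (q i) + gapFun κ (q j) ≤ gapFun κ a + gapFun κ b := by
    intro i j hij a b ha hb hab
    let q' : ι → ℝ := fun k => if k = i then a else if k = j then b else q k
    have hi : q' i = a := by simp [q']
    have hj : q' j = b := by simp [q', hij.symm]
    have hrest : ∀ k ∈ (Finset.univ.erase i).erase j, q' k = q k := by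
      intro k hk
      simp only [Finset.mem_erase, Finset.mem_univ, and_true] at hk
      simp [q', hk.1, hk.2]
    have hq' : q' ∈ stdSimplex ℝ ι := by
      refine ⟨fun k => ?_, ?_⟩
      · simp only [q']; split_ifs
        exacts [ha, hb, hq0 k]
      · have h := hsplit q i j hij
        rw [hsplit q' i j hij, hi, hj, Finset.sum_congr rfl hrest]
        linarith
    have h := hmin hq'
    simp only [Set.mem_ofPred_eq] at h
    have hrest' : ∑ k ∈ (Finset.univ.erase i).erase j, gapFun κ (q' k) =
        ∑ k ∈ (Finset.univ.erase i).erase j, gapFun κ (q k) :=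
      Finset.sum_congr rfl fun k hk => by rw [hrest k hk]
    rw [hsplit (fun k => gapFun κ (q k)) i j hij, hsplit (fun k => gapFun κ (q' k)) i j hij,
      hi, hj, hrest'] at h
    linarith
  set s := κ / (1 + κ) with hs
  have hs0 : 0 < s := by positivity
  have hle1 : ∀ i, q i ≤ 1 := fun i => by
    rw [← hq1]; exact Finset.single_le_sum (f := q) (fun k _ => hq0 k) (Finset.mem_univ i)
  have hequal : ∀ i j, q i ≤ s → q j ≤ s → q i = q j := by
    intro i j hi hj
    by_contra hne
    have hij : i ≠ j := fun h => hne (by rw [h])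
    have h := (strictConvexOn_gapFun hκ0).2 ⟨hq0 i, hi⟩ ⟨hq0 j, hj⟩ hne
      (by norm_num : (0 : ℝ) < 1 / 2) (by norm_num : (0 : ℝ) < 1 / 2) (by norm_num)
    have h2 := hpert i j hij ((1 / 2 : ℝ) • q i + (1 / 2 : ℝ) • q j)
      ((1 / 2 : ℝ) • q i + (1 / 2 : ℝ) • q j)
      (by have := hq0 i; have := hq0 j; simp only [smul_eq_mul]; linarith)
      (by have := hq0 i; have := hq0 j; simp only [smul_eq_mul]; linarith)
      (by simp only [smul_eq_mul]; ring)
    simp only [smul_eq_mul] at h h2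
    linarith
  have hone : ∀ i j, i ≠ j → s < q i → q j ≤ s := by
    intro i j hij hi
    by_contra! hj
    wlog hji : q j ≤ q i generalizing i j
    · exact this j i hij.symm hj hi (le_of_not_ge hji)
    -- pushing the two coordinates apart decreases the sum
    have hsum : q i + q j ≤ 1 := by
      have h := hsplit q i j hij
      have : 0 ≤ ∑ k ∈ (Finset.univ.erase i).erase j, q k := Finset.sum_nonneg fun k _ => hq0 k
      linarith
    set e := q j - s with he
    have he0 : 0 < e := by linarith
    have hd : 0 < q i - q j + 2 * e := by linarith
    have hms : q i + e ∈ Set.Icc s 1 := ⟨by linarith, by linarith⟩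
    have hs1 : s ∈ Set.Icc s 1 := ⟨le_rfl, by linarith⟩
    have h := @(strictConcaveOn_gapFun hκ0).2 (q i + e) hms s hs1 (by linarith)
    set d := q i - q j + 2 * e with hdd
    have h3 := @h ((d - e) / d) (e / d) (div_pos (by linarith) hd) (div_pos he0 hd)
      (by field_simp; ring)
    have h4 := @h (e / d) ((d - e) / d) (div_pos he0 hd) (div_pos (by linarith) hd)
      (by field_simp; ring)
    have e1 : ((d - e) / d) • (q i + e) + (e / d) • s = q i := by
      simp only [smul_eq_mul]; field_simp; simp only [hdd, he]; ring
    have e2 : (e / d) • (q i + e) + ((d - e) / d) • s = q j := by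
      simp only [smul_eq_mul]; field_simp; simp only [hdd, he]; ring
    rw [e1] at h3
    rw [e2] at h4
    have h5 := hpert i j hij (q i + e) s (by linarith [hq0 i]) hs0.le (by linarith)
    simp only [smul_eq_mul] at h3 h4
    have h6 : (d - e) / d + e / d = 1 := by field_simp; ring
    have h7 : (d - e) / d * gapFun κ (q i + e) + e / d * gapFun κ s +
      (e / d * gapFun κ (q i + e) + (d - e) / d * gapFun κ s) =
      ((d - e) / d + e / d) * (gapFun κ (q i + e) + gapFun κ s) := by ring
    rw [h6, one_mul] at h7
    linarith
  -- a largest coordinate `t`; the others are equal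
  have : Nonempty ι := Fintype.card_pos_iff.1 (by omega)
  obtain ⟨i₀, -, hi₀⟩ := Finset.exists_max_image Finset.univ q Finset.univ_nonempty
  have hothers : ∀ j ∈ Finset.univ.erase i₀, q j = (1 - q i₀) / (n - 1) := by
    have hs' : ∀ j, j ≠ i₀ → q j ≤ s := by
      intro j hj
      rcases le_or_gt (q i₀) s with h | h
      · exact (hi₀ j (Finset.mem_univ j)).trans h
      · exact hone i₀ j hj.symm h
    intro j hj
    have hsum := Finset.add_sum_erase Finset.univ q (Finset.mem_univ i₀)
    rw [hq1, Finset.sum_congr rfl fun k hk => hequal k j (hs' k (Finset.ne_of_mem_erase hk))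
      (hs' j (Finset.ne_of_mem_erase hj)), Finset.sum_const,
      Finset.card_erase_of_mem (Finset.mem_univ _), Finset.card_univ, nsmul_eq_mul,
      Nat.cast_sub (by omega), Nat.cast_one] at hsum
    rw [eq_div_iff (by linarith)]
    linarith
  have hval : ∑ i, gapFun κ (q i) = gapSum (n - 1) κ (q i₀) := by
    rw [← Finset.add_sum_erase Finset.univ (fun i => gapFun κ (q i)) (Finset.mem_univ i₀),
      Finset.sum_congr rfl fun k hk => by rw [hothers k hk], Finset.sum_const,
      Finset.card_erase_of_mem (Finset.mem_univ _), Finset.card_univ, nsmul_eq_mul,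
      Nat.cast_sub (by omega), Nat.cast_one, gapSum]
  change 0 ≤ ∑ i, gapFun κ (q i)
  rw [hval]
  refine gapSum_nonneg (by linarith) ?_ ⟨?_, hle1 i₀⟩
  · rw [sub_add_cancel]; exact hκ
  · rw [sub_add_cancel, div_le_iff₀ (by linarith)]
    have : ∑ i, q i ≤ ∑ _i : ι, q i₀ := Finset.sum_le_sum fun i _ => hi₀ i (Finset.mem_univ i)
    rw [hq1, Finset.sum_const, Finset.card_univ, nsmul_eq_mul] at this
    linarith

/-! ### Averaging over random partitions into blocks of equal size -/

/-- For a nonnegative weight `q`, the mass of `S` times the entropy of `q` conditioned on `S`. -/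
noncomputable def withinEntropy {γ : Type*} (q : γ → ℝ) (S : Finset γ) : ℝ :=
  ∑ y ∈ S, Real.negMulLog (q y) - Real.negMulLog (∑ y ∈ S, q y)

section Averaging

variable {γ : Type*} [DecidableEq γ]

/-- Removing a random point from a set `S` of `n` points multiplies the conditional entropy
`withinEntropy q S` by at most `(1 - 1 / n) * log (n - 1) / log n` on average. -/
lemma sum_withinEntropy_erase_le {q : γ → ℝ} (hq : ∀ y, 0 ≤ q y) (S : Finset γ)
    (hS : 2 ≤ S.card) :
    (∑ x ∈ S, withinEntropy q (S.erase x)) * Real.log S.card ≤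
      ((S.card : ℝ) - 1) * Real.log ((S.card : ℝ) - 1) * withinEntropy q S := by
  set n : ℝ := (S.card : ℝ) with hn
  have hn2 : (2 : ℝ) ≤ n := by rw [hn]; exact_mod_cast hS
  have hlog : 0 < Real.log n := Real.log_pos (by linarith)
  set Q := ∑ y ∈ S, q y with hQ
  have hQ0 : 0 ≤ Q := Finset.sum_nonneg fun y _ => hq y
  have hE : ∀ x ∈ S, ∑ y ∈ S.erase x, q y = Q - q x := by
    intro x hx
    have := Finset.add_sum_erase S q hx
    linarith
  have hsum : ∑ x ∈ S, withinEntropy q (S.erase x) =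
      (n - 1) * ∑ y ∈ S, Real.negMulLog (q y) - ∑ x ∈ S, Real.negMulLog (Q - q x) := by
    have h1 : ∀ x ∈ S, withinEntropy q (S.erase x) =
        (∑ y ∈ S, Real.negMulLog (q y) - Real.negMulLog (q x)) - Real.negMulLog (Q - q x) := by
      intro x hx
      have := Finset.add_sum_erase S (fun y => Real.negMulLog (q y)) hx
      rw [withinEntropy, hE x hx]
      linarith
    rw [Finset.sum_congr rfl h1, Finset.sum_sub_distrib, Finset.sum_sub_distrib, Finset.sum_const,
      nsmul_eq_mul, ← hn]
    ring
  rcases hQ0.eq_or_lt with h0 | hpos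
  · have hz : ∀ y ∈ S, q y = 0 :=
      (Finset.sum_eq_zero_iff_of_nonneg fun y _ => hq y).1 h0.symm
    have e1 : ∑ y ∈ S, Real.negMulLog (q y) = 0 :=
      Finset.sum_eq_zero fun y hy => by rw [hz y hy, Real.negMulLog_zero]
    have e2 : ∑ x ∈ S, Real.negMulLog (Q - q x) = 0 :=
      Finset.sum_eq_zero fun y hy => by rw [hz y hy, ← h0, sub_zero, Real.negMulLog_zero]
    rw [hsum, withinEntropy, ← hQ, e1, e2, ← h0]
    simp
  · set κ := (n - 1) * (Real.log n - Real.log (n - 1)) / Real.log n with hκ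
    have hκlog : κ * Real.log n = (n - 1) * (Real.log n - Real.log (n - 1)) := by
      rw [hκ]; field_simp
    have hκ0 : 0 < κ := by
      refine div_pos (mul_pos (by linarith) (sub_pos.2 ?_)) hlog
      exact Real.log_lt_log (by linarith) (by linarith)
    have hcard : Fintype.card S = S.card := Fintype.card_coe S
    have hgap := sum_gap_nonneg (ι := S) (by rw [hcard]; exact hS) hκ0
      (by rw [hcard]; exact hκlog) (fun y => q y / Q)
      ⟨fun y => div_nonneg (hq y) hQ0, by
        rw [← Finset.sum_div, Finset.sum_coe_sort S q, ← hQ, div_self hpos.ne']⟩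
    rw [Finset.sum_coe_sort S (fun y => gapFun κ (q y / Q))] at hgap
    have h1 : ∀ y, Q * Real.negMulLog (q y / Q) =
        Real.negMulLog (q y) - q y / Q * Real.negMulLog Q := by
      intro y
      have h := Real.negMulLog_mul Q (q y / Q)
      rw [mul_div_cancel₀ _ hpos.ne'] at h
      linarith
    have h2 : ∀ y, Q * Real.negMulLog (1 - q y / Q) =
        Real.negMulLog (Q - q y) - (1 - q y / Q) * Real.negMulLog Q := by
      intro y
      have h := Real.negMulLog_mul Q (1 - q y / Q)
      rw [mul_sub, mul_one, mul_div_cancel₀ _ hpos.ne'] at h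
      linarith
    have hdiv : ∑ y ∈ S, q y / Q = 1 := by rw [← Finset.sum_div, ← hQ, div_self hpos.ne']
    have s1 : Q * ∑ y ∈ S, Real.negMulLog (q y / Q) =
        ∑ y ∈ S, Real.negMulLog (q y) - Real.negMulLog Q := by
      rw [Finset.mul_sum, Finset.sum_congr rfl fun y _ => h1 y, Finset.sum_sub_distrib,
        ← Finset.sum_mul, hdiv, one_mul]
    have s2 : Q * ∑ y ∈ S, Real.negMulLog (1 - q y / Q) =
        ∑ y ∈ S, Real.negMulLog (Q - q y) - (n - 1) * Real.negMulLog Q := by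
      rw [Finset.mul_sum, Finset.sum_congr rfl fun y _ => h2 y, Finset.sum_sub_distrib,
        ← Finset.sum_mul, Finset.sum_sub_distrib, hdiv, Finset.sum_const, nsmul_eq_mul, mul_one]
    have hgap' : κ * (Q * ∑ y ∈ S, Real.negMulLog (q y / Q)) ≤
        Q * ∑ y ∈ S, Real.negMulLog (1 - q y / Q) := by
      simp only [gapFun, Finset.sum_sub_distrib, ← Finset.mul_sum] at hgap
      have := mul_nonneg hQ0 hgap
      linarith
    rw [s1, s2] at hgap'
    rw [hsum, withinEntropy, ← hQ]
    set Hq := ∑ y ∈ S, Real.negMulLog (q y)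
    set G := ∑ x ∈ S, Real.negMulLog (Q - q x)
    set L := Real.negMulLog Q
    have : ((n - 1) * Hq - G) * Real.log n ≤ ((n - 1) * (Hq - L) - κ * (Hq - L)) * Real.log n := by
      exact mul_le_mul_of_nonneg_right (by linarith) hlog.le
    refine this.trans (le_of_eq ?_)
    rw [show ((n - 1) * (Hq - L) - κ * (Hq - L)) * Real.log n =
      ((n - 1) * Real.log n - κ * Real.log n) * (Hq - L) by ring, hκlog]
    ring

variable [Fintype γ]

/-- The sum of `withinEntropy q` over all images of `S` under permutations. -/
noncomputable def permEntropy (q : γ → ℝ) (S : Finset γ) : ℝ :=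
  ∑ σ : Equiv.Perm γ, withinEntropy q (S.map σ.toEmbedding)

lemma permEntropy_eq_of_card (q : γ → ℝ) {S T : Finset γ} (h : S.card = T.card) :
    permEntropy q S = permEntropy q T := by
  obtain ⟨τ, hτ⟩ : ∃ τ : Equiv.Perm γ, S.map τ.toEmbedding = T := by
    have e : {x // x ∈ S} ≃ {x // x ∈ T} := Finset.equivOfCardEq h
    refine ⟨e.extendSubtype, Finset.eq_of_subset_of_card_le ?_ (by rw [Finset.card_map, h])⟩
    intro y hy
    obtain ⟨x, hx, rfl⟩ := Finset.mem_map.1 hy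
    exact e.extendSubtype_mem x hx
  rw [← hτ]
  unfold permEntropy
  rw [← Equiv.sum_comp (Equiv.mulRight τ)]
  refine Finset.sum_congr rfl fun σ _ => ?_
  rw [Finset.map_map]
  rfl

lemma permEntropy_erase_le {q : γ → ℝ} (hq : ∀ y, 0 ≤ q y) (S : Finset γ)
    (hS : 2 ≤ S.card) {x : γ} (hx : x ∈ S) :
    permEntropy q (S.erase x) * (S.card * Real.log S.card) ≤
      ((S.card : ℝ) - 1) * Real.log ((S.card : ℝ) - 1) * permEntropy q S := by
  have h1 : permEntropy q (S.erase x) * S.card = ∑ z ∈ S, permEntropy q (S.erase z) := by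
    rw [Finset.sum_congr rfl fun z hz => permEntropy_eq_of_card q (T := S.erase x)
      (by rw [Finset.card_erase_of_mem hz, Finset.card_erase_of_mem hx]),
      Finset.sum_const, nsmul_eq_mul, mul_comm]
  rw [← mul_assoc, h1]
  unfold permEntropy
  rw [Finset.sum_comm, Finset.sum_mul, Finset.mul_sum]
  refine Finset.sum_le_sum fun σ _ => ?_
  have h2 := sum_withinEntropy_erase_le hq (S.map σ.toEmbedding) (by rwa [Finset.card_map])
  rw [Finset.sum_map, Finset.card_map] at h2
  simpa only [Finset.map_erase] using h2

lemma permEntropy_le {q : γ → ℝ} (hq : ∀ y, 0 ≤ q y) (S : Finset γ) (hS : S.Nonempty) :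
    permEntropy q S * (Fintype.card γ * Real.log (Fintype.card γ)) ≤
      S.card * Real.log S.card * permEntropy q Finset.univ := by
  obtain ⟨m, hm⟩ : ∃ m, m = Fintype.card γ - S.card := ⟨_, rfl⟩
  induction m generalizing S with
  | zero =>
    have : S = Finset.univ := by
      rw [← Finset.card_eq_iff_eq_univ]
      have := S.card_le_univ
      omega
    subst this
    rw [Finset.card_univ, mul_comm]
  | succ m ih =>
    obtain ⟨x, hx⟩ : ∃ x, x ∉ S := by
      by_contra! hall
      rw [Finset.eq_univ_of_forall hall, Finset.card_univ] at hm
      omega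
    have hc : (insert x S).card = S.card + 1 := Finset.card_insert_of_notMem hx
    have hpos := hS.card_pos
    have ih' := ih (insert x S) (Finset.insert_nonempty _ _) (by rw [hc]; omega)
    have hst := permEntropy_erase_le hq (insert x S) (by rw [hc]; omega)
      (Finset.mem_insert_self x S)
    rw [Finset.erase_insert hx, hc, Nat.cast_add, Nat.cast_one, add_sub_cancel_right] at hst
    rw [hc, Nat.cast_add, Nat.cast_one] at ih'
    have hs1 : (1 : ℝ) ≤ S.card := by exact_mod_cast hpos
    have hlog : 0 < Real.log ((S.card : ℝ) + 1) := Real.log_pos (by linarith)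
    have hD : 0 < ((S.card : ℝ) + 1) * Real.log ((S.card : ℝ) + 1) := by positivity
    have hNN : 0 ≤ (Fintype.card γ : ℝ) * Real.log (Fintype.card γ) := by
      refine mul_nonneg (Nat.cast_nonneg _) (Real.log_natCast_nonneg _)
    have hss : 0 ≤ (S.card : ℝ) * Real.log S.card :=
      mul_nonneg (Nat.cast_nonneg _) (Real.log_natCast_nonneg _)
    refine le_of_mul_le_mul_right ?_ hD
    calc _ = permEntropy q S * ((S.card + 1) * Real.log (S.card + 1)) *
          (Fintype.card γ * Real.log (Fintype.card γ)) := by ring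
      _ ≤ S.card * Real.log S.card * permEntropy q (insert x S) *
          (Fintype.card γ * Real.log (Fintype.card γ)) := by gcongr
      _ = S.card * Real.log S.card * (permEntropy q (insert x S) *
          (Fintype.card γ * Real.log (Fintype.card γ))) := by ring
      _ ≤ S.card * Real.log S.card * ((S.card + 1) * Real.log (S.card + 1) *
          permEntropy q Finset.univ) := by gcongr
      _ = _ := by ring

end Averaging

section RandomLabel

lemma labelEntropy_eq_sum {E κ : Type*} [Fintype E] [DecidableEq κ] {p : E → ℝ} (f : E → κ)
    (T : Finset κ) (hT : ∀ x, f x ∈ T) :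
    labelEntropy p f = ∑ w ∈ T, Real.negMulLog (∑ x with f x = w, p x) := by
  classical
  unfold labelEntropy
  rw [← Finset.sum_fiberwise_of_maps_to (s := Finset.univ) (t := T) (g := f) fun x _ => hT x]
  refine Finset.sum_congr rfl fun w _ => ?_
  have : ∀ x ∈ Finset.univ.filter (fun x => f x = w), p x * -Real.log (fiberMass p f x) =
      p x * -Real.log (∑ x with f x = w, p x) := by
    intro x hx
    have hxw : f x = w := (Finset.mem_filter.1 hx).2
    unfold fiberMass
    rw [hxw]
    congr!
  rw [Finset.sum_congr rfl this, ← Finset.sum_mul, Real.negMulLog]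
  ring

variable {E A B κ : Type*} [Fintype E] [Fintype A] [Fintype B] [DecidableEq A] [DecidableEq B]
  [DecidableEq κ] {p : E → ℝ}

/-- The sum of the conditional entropies given the value `v` of `X` and the class `g y`. -/
lemma labelEntropy_sub_eq {γ : Type*} [Fintype γ] [DecidableEq γ] (Y : E → γ) (g : γ → A)
    (X : E → κ) :
    labelEntropy p (fun e => (Y e, X e)) - labelEntropy p (fun e => (g (Y e), X e)) =
      ∑ v ∈ Finset.univ.image X, ∑ a, withinEntropy (fun y => ∑ e with X e = v ∧ Y e = y, p e)
        {y | g y = a} := by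
  rw [labelEntropy_eq_sum (fun e => (Y e, X e)) (Finset.univ ×ˢ Finset.univ.image X)
      (fun e => by simp),
    labelEntropy_eq_sum (fun e => (g (Y e), X e)) (Finset.univ ×ˢ Finset.univ.image X)
      (fun e => by simp), Finset.sum_product_right, Finset.sum_product_right,
    ← Finset.sum_sub_distrib]
  refine Finset.sum_congr rfl fun v _ => ?_
  simp only [withinEntropy]
  rw [Finset.sum_sub_distrib]
  congr 1
  · rw [Finset.sum_fiberwise]
    refine Finset.sum_congr rfl fun y _ => ?_
    congr 2
    ext e; simp [and_comm]
  · refine Finset.sum_congr rfl fun a _ => ?_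
    congr 1
    rw [← Finset.sum_fiberwise_of_maps_to (s := Finset.univ.filter fun e => (g (Y e), X e) = (a, v))
      (t := Finset.univ.filter fun y => g y = a) (g := Y)
      (fun e he => by simp only [Finset.mem_filter, Finset.mem_univ, true_and,
                        Prod.mk.injEq] at he ⊢; exact he.1)]
    refine Finset.sum_congr rfl fun y hy => ?_
    congr 1
    ext e
    simp only [Finset.mem_filter, Finset.mem_univ, true_and, Prod.mk.injEq] at hy ⊢
    constructor
    · rintro ⟨⟨_, h2⟩, h3⟩; exact ⟨h2, h3⟩
    · rintro ⟨h2, h3⟩; exact ⟨⟨by rw [h3, hy], h2⟩, h3⟩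

/-- For a uniformly random bijective relabelling `σ` of `A × B`, the average entropy of the pair
consisting of the first coordinate of `σ (Y)` and of `X` is at least the corresponding convex
combination of `H(X)` and `H(Y, X)`, with weights proportional to `log |B|` and `log |A|`. -/
lemma sum_labelEntropy_perm_ge [Nonempty A] [Nonempty B] (hp : ∀ e, 0 ≤ p e) (Y : E → A × B)
    (X : E → κ) :
    Fintype.card (Equiv.Perm (A × B)) *
      (Real.log (Fintype.card B) * labelEntropy p X +
        Real.log (Fintype.card A) * labelEntropy p (fun e => (Y e, X e))) ≤
      (∑ σ : Equiv.Perm (A × B), labelEntropy p (fun e => ((σ (Y e)).1, X e))) *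
        (Real.log (Fintype.card A) + Real.log (Fintype.card B)) := by
  set a : ℝ := (Fintype.card A : ℝ) with ha
  set b : ℝ := (Fintype.card B : ℝ) with hb
  have ha1 : 1 ≤ a := by rw [ha]; exact_mod_cast Fintype.card_pos
  have hb1 : 1 ≤ b := by rw [hb]; exact_mod_cast Fintype.card_pos
  have hN : (Fintype.card (A × B) : ℝ) = a * b := by rw [Fintype.card_prod, Nat.cast_mul]
  have hlogN : Real.log (a * b) = Real.log a + Real.log b :=
    Real.log_mul (by linarith) (by linarith)
  let q : κ → A × B → ℝ := fun v y => ∑ e with X e = v ∧ Y e = y, p e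
  have hq : ∀ v y, 0 ≤ q v y := fun v y => Finset.sum_nonneg fun e _ => hp e
  -- the average for a single value of `X`
  have hv : ∀ v, (∑ σ : Equiv.Perm (A × B), ∑ i : A, withinEntropy (q v) {y | (σ y).1 = i}) *
      Real.log (a * b) ≤ Real.log b *
        (Fintype.card (Equiv.Perm (A × B)) * withinEntropy (q v) Finset.univ) := by
    intro v
    have h1 : ∑ σ : Equiv.Perm (A × B), ∑ i : A, withinEntropy (q v) {y | (σ y).1 = i} =
        ∑ i : A, permEntropy (q v) {y | y.1 = i} := by
      rw [Finset.sum_comm]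
      refine Finset.sum_congr rfl fun i _ => ?_
      unfold permEntropy
      rw [← Equiv.sum_comp (Equiv.inv (Equiv.Perm (A × B)))]
      refine Finset.sum_congr rfl fun σ _ => ?_
      congr 1
      ext y
      simp only [Finset.mem_filter, Finset.mem_univ, true_and, Finset.mem_map_equiv]
      rfl
    have hcardS : ∀ i : A, (Finset.univ.filter fun y : A × B => y.1 = i).card = Fintype.card B := by
      intro i
      rw [show (Finset.univ.filter fun y : A × B => y.1 = i) = {i} ×ˢ Finset.univ by
        ext ⟨x, y⟩; simp [eq_comm]]
      simp
    have h2 : ∀ i : A, permEntropy (q v) {y | y.1 = i} * (a * b * Real.log (a * b)) ≤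
        b * Real.log b * permEntropy (q v) Finset.univ := by
      intro i
      have h := permEntropy_le (hq v) (Finset.univ.filter fun y : A × B => y.1 = i)
        (Finset.card_pos.1 (by rw [hcardS]; exact Fintype.card_pos))
      rwa [hcardS, hN, ← hb] at h
    have h3 : permEntropy (q v) Finset.univ =
        Fintype.card (Equiv.Perm (A × B)) * withinEntropy (q v) Finset.univ := by
      unfold permEntropy
      simp only [Finset.map_univ_equiv, Finset.sum_const, nsmul_eq_mul, Finset.card_univ]
    rw [h1, ← h3]
    have h4 := Finset.sum_le_sum fun i (_ : i ∈ Finset.univ) => h2 i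
    rw [← Finset.sum_mul, Finset.sum_const, nsmul_eq_mul, Finset.card_univ, ← ha] at h4
    have hab : 0 < a * b := by positivity
    refine le_of_mul_le_mul_right ?_ hab
    linarith
  have hX : labelEntropy p X = labelEntropy p (fun e => ((fun _ : A × B => ()) (Y e), X e)) :=
    labelEntropy_congr _ _ fun x y => by simp
  have hsub := labelEntropy_sub_eq (p := p) Y (fun _ => ()) X
  rw [← hX] at hsub
  simp only [Finset.univ_unique, Finset.sum_singleton] at hsub
  have hsub' : labelEntropy p (fun e => (Y e, X e)) - labelEntropy p X =
      ∑ v ∈ Finset.univ.image X, withinEntropy (q v) Finset.univ := by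
    rw [hsub]
    refine Finset.sum_congr rfl fun v _ => ?_
    congr 1
    ext y; simp
  have hσ : ∀ σ : Equiv.Perm (A × B), labelEntropy p (fun e => (Y e, X e)) -
      labelEntropy p (fun e => ((σ (Y e)).1, X e)) =
      ∑ v ∈ Finset.univ.image X, ∑ i : A, withinEntropy (q v) {y | (σ y).1 = i} :=
    fun σ => labelEntropy_sub_eq Y (fun y => (σ y).1) X
  have htot := Finset.sum_congr rfl fun σ (_ : σ ∈ (Finset.univ : Finset (Equiv.Perm (A × B)))) =>
    hσ σ
  rw [Finset.sum_sub_distrib, Finset.sum_const, nsmul_eq_mul, Finset.card_univ,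
    Finset.sum_comm] at htot
  have hle := Finset.sum_le_sum fun v (_ : v ∈ Finset.univ.image X) => hv v
  rw [← Finset.sum_mul, ← htot, ← Finset.mul_sum, ← Finset.mul_sum, ← hsub', hlogN] at hle
  linarith

end RandomLabel

/-! ### Splitting one coordinate into two -/

section Split

variable {ι E : Type*} [DecidableEq ι]

/-- The joint label formed by the labels `X i`, `i ∈ U`; the value `0` fills the other places. -/
def joinLabel (X : ι → E → ℕ) (U : Finset ι) (e : E) (i : ι) : ℕ := if i ∈ U then X i e else 0

lemma joinLabel_eq_iff {X : ι → E → ℕ} {U : Finset ι} {e e' : E} :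
    joinLabel X U e = joinLabel X U e' ↔ ∀ i ∈ U, X i e = X i e' := by
  constructor
  · intro h i hi
    simpa [joinLabel, hi] using congrFun h i
  · intro h
    funext i
    by_cases hi : i ∈ U
    · simp [joinLabel, hi, h i hi]
    · simp [joinLabel, hi]

lemma sum_union_inter_submodular (H : Finset ι → ℝ) (c : ι → ℝ) (r : ℝ)
    (hH : ∀ S T, H (S ∪ T) + H (S ∩ T) ≤ H S + H T) (S T : Finset ι) :
    (H (S ∪ T) - ∑ i ∈ S ∪ T, c i - r) + (H (S ∩ T) - ∑ i ∈ S ∩ T, c i - r) ≤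
      (H S - ∑ i ∈ S, c i - r) + (H T - ∑ i ∈ T, c i - r) := by
  have h1 := hH S T
  have h2 := Finset.sum_union_inter (s₁ := S) (s₂ := T) (f := c)
  linarith

variable {A B : Type*} [Fintype E] [Fintype A] [Fintype B] {p : E → ℝ}
  [DecidableEq A] [DecidableEq B]

/-- Suppose that the labels `X i`, `i ∈ F`, and a label `Y` in `A × B` satisfy all entropy lower
bounds `H(X_U) ≥ c(U)` and `H(Y, X_U) ≥ c(U) + lam * log |A| + lam * log |B|`. Then `Y` can be
relabelled so that its first coordinate satisfies `H(Y₁, X_U) ≥ c(U) + lam * log |A|` for all `U`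
simultaneously. For each single `U` this holds on average over the relabellings. If every
relabelling `σ` violated the bound at some set `U σ`, then submodularity would bound from above the
slack at any other set `V`, and for `V` a suitable quantile set of the family `U σ` this contradicts
the average. -/
lemma exists_perm_fst [Nonempty A] [Nonempty B] (hp : ∀ e, 0 ≤ p e)
    (F : Finset ι) (X : ι → E → ℕ) (Y : E → A × B) (c : ι → ℝ) (lam : ℝ)
    (hg : ∀ U ⊆ F, ∑ i ∈ U, c i ≤ labelEntropy p (joinLabel X U))
    (hh : ∀ U ⊆ F, ∑ i ∈ U, c i + (lam * Real.log (Fintype.card A) +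
      lam * Real.log (Fintype.card B)) ≤ labelEntropy p (fun e => (Y e, joinLabel X U e))) :
    ∃ σ : Equiv.Perm (A × B), ∀ U ⊆ F, ∑ i ∈ U, c i + lam * Real.log (Fintype.card A) ≤
      labelEntropy p (fun e => ((σ (Y e)).1, joinLabel X U e)) := by
  classical
  set a := Real.log (Fintype.card A) with ha
  set b := Real.log (Fintype.card B) with hb
  have ha0 : 0 ≤ a := Real.log_natCast_nonneg _
  have hb0 : 0 ≤ b := Real.log_natCast_nonneg _
  have hmono : ∀ (σ : Equiv.Perm (A × B)) U, labelEntropy p (joinLabel X U) ≤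
      labelEntropy p (fun e => ((σ (Y e)).1, joinLabel X U e)) := by
    intro σ U
    have h := labelEntropy_submodular hp (fun e => ((σ (Y e)).1, joinLabel X U e))
      (joinLabel X U) (joinLabel X U) (joinLabel X U)
      (fun x y h => (Prod.ext_iff.1 h).2) (fun x y h => h) (fun x y _ h => h)
    linarith
  by_contra! hcon
  choose U hUF hU using hcon
  rcases (add_nonneg ha0 hb0).eq_or_lt with hD | hD
  · have : a = 0 := by linarith
    have h1 := hU 1
    have h2 := hg _ (hUF 1)
    have h3 := hmono 1 (U 1)
    rw [this, mul_zero, add_zero] at h1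
    linarith
  set K := Fintype.card (Equiv.Perm (A × B)) with hK
  have hK1 : 1 ≤ K := Fintype.card_pos
  have hK0 : (0 : ℝ) < K := by exact_mod_cast hK1
  set ρ := a / (a + b) with hρ
  have hρ0 : 0 ≤ ρ := div_nonneg ha0 hD.le
  have hρ1 : ρ ≤ 1 := (div_le_one hD).2 (by linarith)
  have hρD : ρ * (a + b) = a := by rw [hρ]; field_simp
  -- the quantile `j = max 1 ⌈K ρ⌉`
  obtain ⟨j, hj1, hjK, hjl, hju⟩ : ∃ j : ℕ, 1 ≤ j ∧ j ≤ K ∧ K * ρ ≤ j ∧ (j : ℝ) - 1 ≤ K * ρ := by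
    refine ⟨max 1 ⌈K * ρ⌉₊, le_max_left _ _, max_le hK1 ?_, ?_, ?_⟩
    · exact Nat.ceil_le.2 (by nlinarith)
    · exact (Nat.le_ceil _).trans (by exact_mod_cast le_max_right _ _)
    · rcases le_total 1 ⌈K * ρ⌉₊ with h | h
      · rw [max_eq_right h]
        have := Nat.ceil_lt_add_one (a := K * ρ) (by positivity)
        linarith
      · rw [max_eq_left h]
        simp only [Nat.cast_one, sub_self]
        positivity
  -- the quantile set: coordinates that lie in at least `j` of the `K` sets `U σ`
  let V : Finset ι := {i ∈ F | j ≤ (Finset.univ.filter fun σ => i ∈ U σ).card}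
  have hVF : V ⊆ F := Finset.filter_subset _ _
  let g : Finset ι → ℝ := fun S => labelEntropy p (joinLabel X S) - ∑ i ∈ S, c i - 0
  let h : Finset ι → ℝ := fun S => labelEntropy p (fun e => (Y e, joinLabel X S e)) -
    ∑ i ∈ S, c i - (lam * a + lam * b)
  have hgsub : ∀ S T, g (S ∪ T) + g (S ∩ T) ≤ g S + g T :=
    sum_union_inter_submodular (fun S => labelEntropy p (joinLabel X S)) c _ fun S T =>
      labelEntropy_submodular hp _ _ _ _
        (fun x y hxy => joinLabel_eq_iff.2 fun i hi =>
          joinLabel_eq_iff.1 hxy i (Finset.mem_inter.1 hi).1)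
        (fun x y hxy => joinLabel_eq_iff.2 fun i hi =>
          joinLabel_eq_iff.1 hxy i (Finset.mem_inter.1 hi).2)
        (fun x y h1 h2 => joinLabel_eq_iff.2 fun i hi => by
          rcases Finset.mem_union.1 hi with hi | hi
          · exact joinLabel_eq_iff.1 h1 i hi
          · exact joinLabel_eq_iff.1 h2 i hi)
  have hhsub : ∀ S T, h (S ∪ T) + h (S ∩ T) ≤ h S + h T :=
    sum_union_inter_submodular (fun S => labelEntropy p (fun e => (Y e, joinLabel X S e))) c _
      fun S T => labelEntropy_submodular hp _ _ _ _
        (fun x y hxy => by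
          rw [Prod.ext_iff] at hxy ⊢
          exact ⟨hxy.1, joinLabel_eq_iff.2 fun i hi =>
            joinLabel_eq_iff.1 hxy.2 i (Finset.mem_inter.1 hi).1⟩)
        (fun x y hxy => by
          rw [Prod.ext_iff] at hxy ⊢
          exact ⟨hxy.1, joinLabel_eq_iff.2 fun i hi =>
            joinLabel_eq_iff.1 hxy.2 i (Finset.mem_inter.1 hi).2⟩)
        (fun x y h1 h2 => by
          rw [Prod.ext_iff] at h1 h2 ⊢
          refine ⟨h1.1, joinLabel_eq_iff.2 fun i hi => ?_⟩
          rcases Finset.mem_union.1 hi with hi | hi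
          · exact joinLabel_eq_iff.1 h1.2 i hi
          · exact joinLabel_eq_iff.1 h2.2 i hi)
  have hg0 : ∀ S ⊆ F, 0 ≤ g S := fun S hS => by
    have := hg S hS
    simp only [g]; linarith
  have hh0 : ∀ S ⊆ F, 0 ≤ h S := fun S hS => by
    have := hh S hS
    simp only [h]; linarith
  have hcov1 : j * g V ≤ ∑ σ, g (U σ ∩ V) := by
    refine mul_le_sum_of_cover g hgsub V (fun S hS => hg0 S (hS.trans hVF)) (fun σ => U σ ∩ V)
      Finset.univ (fun σ _ => Finset.inter_subset_right) j (by rwa [Finset.card_univ]) ?_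
    intro i hi
    refine (Finset.mem_filter.1 hi).2.trans (Finset.card_le_card fun σ hσ => ?_)
    simp only [Finset.mem_filter, Finset.mem_univ, true_and, Finset.mem_inter] at hσ ⊢
    exact ⟨hσ, hi⟩
  have hcov2 : ((K - j + 1 : ℕ) : ℝ) * h V ≤ ∑ σ, h (U σ ∪ V) := by
    refine mul_le_sum_union h hhsub F V hVF hh0 U Finset.univ (fun σ _ => hUF σ) _
      (by rw [Finset.card_univ]; omega) ?_
    intro i hi
    have h1 := Finset.mem_sdiff.1 hi
    have h2 : ¬ j ≤ (Finset.univ.filter fun σ => i ∈ U σ).card := fun hle =>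
      h1.2 (Finset.mem_filter.2 ⟨h1.1, hle⟩)
    have h3 := Finset.card_filter_add_card_filter_not
      (s := (Finset.univ : Finset (Equiv.Perm (A × B)))) (fun σ => i ∈ U σ)
    rw [Finset.card_univ] at h3
    omega
  -- submodularity twice: the first-coordinate slack at `V`, given that it is negative at `U σ`
  have hVbound : ∀ σ : Equiv.Perm (A × B),
      labelEntropy p (fun e => ((σ (Y e)).1, joinLabel X V e)) - ∑ i ∈ V, c i - lam * a <
        (g V - g (U σ ∩ V)) + (h V - h (U σ ∪ V)) := by
    intro σ
    have h1 := labelEntropy_submodular hp (joinLabel X V)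
      (fun e => ((σ (Y e)).1, joinLabel X (U σ ∩ V) e))
      (fun e => ((σ (Y e)).1, joinLabel X V e)) (joinLabel X (U σ ∩ V))
      (fun x y hxy => joinLabel_eq_iff.2 fun i hi =>
          joinLabel_eq_iff.1 hxy i (Finset.mem_inter.1 hi).2)
      (fun x y hxy => (Prod.ext_iff.1 hxy).2)
      (fun x y h1 h2 => Prod.ext (Prod.ext_iff.1 h2).1 h1)
    have h2 := labelEntropy_submodular hp (fun e => ((σ (Y e)).1, joinLabel X (U σ) e))
      (fun e => (Y e, joinLabel X V e))
      (fun e => (Y e, joinLabel X (U σ ∪ V) e))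
      (fun e => ((σ (Y e)).1, joinLabel X (U σ ∩ V) e))
      (fun x y hxy => by
        rw [Prod.ext_iff] at hxy ⊢
        exact ⟨hxy.1, joinLabel_eq_iff.2 fun i hi =>
          joinLabel_eq_iff.1 hxy.2 i (Finset.mem_inter.1 hi).1⟩)
      (fun x y hxy => by
        rw [Prod.ext_iff] at hxy ⊢
        refine ⟨by simp only at hxy ⊢; rw [hxy.1], joinLabel_eq_iff.2 fun i hi =>
          joinLabel_eq_iff.1 hxy.2 i (Finset.mem_inter.1 hi).2⟩)
      (fun x y h1 h2 => by
        rw [Prod.ext_iff] at h1 h2 ⊢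
        refine ⟨h2.1, joinLabel_eq_iff.2 fun i hi => ?_⟩
        rcases Finset.mem_union.1 hi with hi | hi
        · exact joinLabel_eq_iff.1 h1.2 i hi
        · exact joinLabel_eq_iff.1 h2.2 i hi)
    have h3 := hU σ
    have h4 := Finset.sum_union_inter (s₁ := U σ) (s₂ := V) (f := c)
    simp only [g, h]
    linarith
  have e1 : (K : ℝ) * (b * labelEntropy p (joinLabel X V) +
      a * labelEntropy p (fun e => (Y e, joinLabel X V e))) =
      K * (b * g V + a * h V) + (a + b) * (K * ∑ i ∈ V, c i + K * (lam * a)) := by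
    simp only [g, h]; ring
  clear_value g h
  have hsum := Finset.sum_lt_sum_of_nonempty (s := (Finset.univ : Finset (Equiv.Perm (A × B))))
    Finset.univ_nonempty fun σ _ => hVbound σ
  rw [Finset.sum_add_distrib, Finset.sum_sub_distrib, Finset.sum_sub_distrib,
    Finset.sum_sub_distrib, Finset.sum_sub_distrib] at hsum
  simp only [Finset.sum_const, nsmul_eq_mul, Finset.card_univ] at hsum
  rw [← hK] at hsum
  have havg := sum_labelEntropy_perm_ge (p := p) hp Y (joinLabel X V)
  rw [← hK, ← ha, ← hb] at havg
  set S := ∑ σ : Equiv.Perm (A × B), labelEntropy p (fun e => ((σ (Y e)).1, joinLabel X V e))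
  rw [Nat.cast_add, Nat.cast_sub hjK, Nat.cast_one] at hcov2
  have hgV := hg0 V hVF
  have hhV := hh0 V hVF
  have e2 : S - K * ∑ i ∈ V, c i - K * (lam * a) < K * (1 - ρ) * g V + K * ρ * h V := by
    have i1 : (K - j : ℝ) * g V ≤ K * (1 - ρ) * g V :=
      mul_le_mul_of_nonneg_right (by linarith) hgV
    have i2 : ((j : ℝ) - 1) * h V ≤ K * ρ * h V := mul_le_mul_of_nonneg_right hju hhV
    linarith
  have e3 := mul_lt_mul_of_pos_right e2 hD
  have e4 : (K * (1 - ρ) * g V + K * ρ * h V) * (a + b) = K * (b * g V + a * h V) := by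
    rw [show (K * (1 - ρ) * g V + K * ρ * h V) * (a + b) =
      K * ((a + b) - ρ * (a + b)) * g V + K * (ρ * (a + b)) * h V by ring, hρD]
    ring
  rw [e1] at havg
  rw [e4] at e3
  linarith

/-- Under the assumptions of `exists_perm_fst`, one relabelling serves both coordinates of `Y`. By
submodularity a relabelling cannot violate a bound for each of the two coordinates, and the bounds
for one coordinate are insensitive to transpositions that change only the other one; such
transpositions generate all permutations of `A × B`. -/
lemma exists_perm_both [Nonempty A] [Nonempty B] (hp : ∀ e, 0 ≤ p e)
    (F : Finset ι) (X : ι → E → ℕ) (Y : E → A × B) (c : ι → ℝ) (lam : ℝ)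
    (hg : ∀ U ⊆ F, ∑ i ∈ U, c i ≤ labelEntropy p (joinLabel X U))
    (hh : ∀ U ⊆ F, ∑ i ∈ U, c i + (lam * Real.log (Fintype.card A) +
      lam * Real.log (Fintype.card B)) ≤ labelEntropy p (fun e => (Y e, joinLabel X U e))) :
    ∃ σ : Equiv.Perm (A × B),
      (∀ U ⊆ F, ∑ i ∈ U, c i + lam * Real.log (Fintype.card A) ≤
        labelEntropy p (fun e => ((σ (Y e)).1, joinLabel X U e))) ∧
      ∀ U ⊆ F, ∑ i ∈ U, c i + lam * Real.log (Fintype.card B) ≤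
        labelEntropy p (fun e => ((σ (Y e)).2, joinLabel X U e)) := by
  classical
  let S₁ : Equiv.Perm (A × B) → Prop := fun σ => ∀ U ⊆ F,
    ∑ i ∈ U, c i + lam * Real.log (Fintype.card A) ≤
      labelEntropy p (fun e => ((σ (Y e)).1, joinLabel X U e))
  let S₂ : Equiv.Perm (A × B) → Prop := fun σ => ∀ U ⊆ F,
    ∑ i ∈ U, c i + lam * Real.log (Fintype.card B) ≤
      labelEntropy p (fun e => ((σ (Y e)).2, joinLabel X U e))
  change ∃ σ, S₁ σ ∧ S₂ σ
  obtain ⟨σ₁, hσ₁⟩ : ∃ σ, S₁ σ := exists_perm_fst hp F X Y c lam hg hh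
  obtain ⟨σ₂, hσ₂⟩ : ∃ σ, S₂ σ := by
    obtain ⟨τ, hτ⟩ := exists_perm_fst hp F X (fun e => (Y e).swap) c lam hg fun U hU => by
      rw [add_comm (lam * Real.log (Fintype.card B))]
      refine (hh U hU).trans (le_of_eq (labelEntropy_congr _ _ fun x y => ?_))
      simp only [Prod.mk.injEq, Prod.swap_inj]
    exact ⟨((Equiv.prodComm A B).trans τ).trans (Equiv.prodComm B A), hτ⟩
  -- a relabelling bad for both coordinates would contradict submodularity
  have hor : ∀ σ, S₁ σ ∨ S₂ σ := by
    intro σ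
    by_contra! hno
    obtain ⟨h1, h2⟩ := hno
    simp only [S₁, S₂] at h1 h2
    push Not at h1 h2
    obtain ⟨U, hUF, hU⟩ := h1
    obtain ⟨U', hUF', hU'⟩ := h2
    have hsub := labelEntropy_submodular hp (fun e => ((σ (Y e)).1, joinLabel X U e))
      (fun e => ((σ (Y e)).2, joinLabel X U' e)) (fun e => (Y e, joinLabel X (U ∪ U') e))
      (joinLabel X (U ∩ U'))
      (fun x y hxy => joinLabel_eq_iff.2 fun i hi =>
          joinLabel_eq_iff.1 (Prod.ext_iff.1 hxy).2 i (Finset.mem_inter.1 hi).1)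
      (fun x y hxy => joinLabel_eq_iff.2 fun i hi =>
          joinLabel_eq_iff.1 (Prod.ext_iff.1 hxy).2 i (Finset.mem_inter.1 hi).2)
      (fun x y h1 h2 => by
        rw [Prod.ext_iff] at h1 h2 ⊢
        refine ⟨σ.injective (Prod.ext h1.1 h2.1), joinLabel_eq_iff.2 fun i hi => ?_⟩
        rcases Finset.mem_union.1 hi with hi | hi
        · exact joinLabel_eq_iff.1 h1.2 i hi
        · exact joinLabel_eq_iff.1 h2.2 i hi)
    have h3 := hh (U ∪ U') (Finset.union_subset hUF hUF')
    have h4 := hg (U ∩ U') (Finset.inter_subset_left.trans hUF)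
    have h5 := Finset.sum_union_inter (s₁ := U) (s₂ := U') (f := c)
    linarith
  by_contra! hnone
  -- so, were there no common good one, the two kinds of good relabelling would be complementary
  have hiff : ∀ σ, S₁ σ ↔ ¬ S₂ σ := fun σ => ⟨hnone σ, (hor σ).resolve_right⟩
  have hrow : ∀ x y : A × B, x.1 = y.1 → ∀ σ, S₁ (Equiv.swap x y * σ) ↔ S₁ σ := by
    intro x y hxy σ
    have : ∀ z, (Equiv.swap x y z).1 = z.1 := by
      intro z
      rw [Equiv.swap_apply_def]
      split_ifs with h1 h2
      · rw [h1, hxy]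
      · rw [h2, hxy]
      · rfl
    simp only [S₁, Equiv.Perm.mul_apply, this]
  have hcol : ∀ x y : A × B, x.2 = y.2 → ∀ σ, S₁ (Equiv.swap x y * σ) ↔ S₁ σ := by
    intro x y hxy σ
    have : ∀ z, (Equiv.swap x y z).2 = z.2 := by
      intro z
      rw [Equiv.swap_apply_def]
      split_ifs with h1 h2
      · rw [h1, hxy]
      · rw [h2, hxy]
      · rfl
    rw [hiff, hiff]
    simp only [S₂, Equiv.Perm.mul_apply, this]
  have hswap : ∀ x y : A × B, ∀ σ, S₁ (Equiv.swap x y * σ) ↔ S₁ σ := by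
    intro x y σ
    by_cases h1 : x.1 = y.1
    · exact hrow x y h1 σ
    by_cases h2 : x.2 = y.2
    · exact hcol x y h2 σ
    -- a general transposition is a product of three that change one coordinate each
    have hzx : y ≠ (y.1, x.2) := fun h => h2 (by rw [h])
    have hzy : y ≠ x := fun h => h1 (by rw [h])
    have := Equiv.swap_mul_swap_mul_swap (x := y) (y := (y.1, x.2)) (z := x) hzx hzy
    rw [← this, mul_assoc, mul_assoc, hcol (y.1, x.2) x rfl,
      hrow y (y.1, x.2) rfl, hcol (y.1, x.2) x rfl]
  have hall : ∀ τ σ, S₁ (τ * σ) ↔ S₁ σ := by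
    intro τ
    induction τ using Equiv.Perm.swap_induction_on with
    | one => intro σ; rw [one_mul]
    | swap_mul f x y _ ih => intro σ; rw [mul_assoc, hswap, ih]
  exact hnone σ₂ (by rw [← hall (σ₁ * σ₂⁻¹)]; simpa using hσ₁) hσ₂

end Split

/-! ### Arranging a distribution on a product set -/

/-- A law `p` on a finite set `E` of size `d₀ * ∏ i ∈ s, d i` can be arranged on the product of sets
of sizes `d₀` and `d i` so that every subset of the coordinates carries at least its share of the
entropy, the shares being proportional to the logarithms of the sizes. Built by splitting off one
coordinate at a time. -/
lemma exists_arrangement {ι E : Type*} [DecidableEq ι] [Fintype E] [DecidableEq E] {p : E → ℝ}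
    (hp : ∀ e, 0 ≤ p e) (hp1 : ∑ e, p e = 1) (lam : ℝ)
    (hlam : lam * Real.log (Fintype.card E) = ∑ e, Real.negMulLog (p e)) (d : ι → ℕ)
    (s : Finset ι) (d₀ : ℕ) (hd : d₀ * ∏ i ∈ s, d i = Fintype.card E) :
    ∃ (Y : E → Fin d₀) (X : ι → E → ℕ), (∀ i ∈ s, ∀ e, X i e < d i) ∧
      (∀ x y, Y x = Y y → (∀ i ∈ s, X i x = X i y) → x = y) ∧
      ∀ U ⊆ s, ∑ i ∈ U, lam * Real.log (d i) ≤ labelEntropy p (joinLabel X U) ∧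
        ∑ i ∈ U, lam * Real.log (d i) + lam * Real.log d₀ ≤
          labelEntropy p (fun e => (Y e, joinLabel X U e)) := by
  have hEpos : 0 < Fintype.card E := by
    by_contra! h0
    have : IsEmpty E := Fintype.card_eq_zero_iff.1 (by omega)
    simp at hp1
  induction s using Finset.induction_on generalizing d₀ with
  | empty =>
    rw [Finset.prod_empty, mul_one] at hd
    let Y : E ≃ Fin d₀ := Fintype.equivFinOfCardEq hd.symm
    refine ⟨Y, fun _ _ => 0, by simp, fun x y hxy _ => Y.injective hxy, ?_⟩
    intro U hU
    have hl : lam * Real.log (d₀ : ℝ) = ∑ e, Real.negMulLog (p e) := by rw [← hlam, hd]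
    rw [Finset.subset_empty.1 hU, Finset.sum_empty, zero_add, hl]
    refine ⟨?_, ?_⟩
    · rw [labelEntropy_const hp1 _ fun x y => rfl]
    · rw [labelEntropy_of_injective]
      intro x y hxy
      exact Y.injective (Prod.ext_iff.1 hxy).1
  | insert j s hj ih =>
    rw [Finset.prod_insert hj, ← mul_assoc] at hd
    obtain ⟨Y₀, X, hXlt, hinj, hbd⟩ := ih (d₀ * d j) hd
    have hpos : 0 < d₀ * d j * ∏ i ∈ s, d i := by rw [hd]; exact hEpos
    have hd0 : 0 < d₀ := Nat.pos_of_mul_pos_right (Nat.pos_of_mul_pos_right hpos)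
    have hdj : 0 < d j := Nat.pos_of_mul_pos_left (Nat.pos_of_mul_pos_right hpos)
    have : Nonempty (Fin d₀) := ⟨⟨0, hd0⟩⟩
    have : Nonempty (Fin (d j)) := ⟨⟨0, hdj⟩⟩
    let Yp : E → Fin d₀ × Fin (d j) := fun e => finProdFinEquiv.symm (Y₀ e)
    have hYp : ∀ x y, Yp x = Yp y ↔ Y₀ x = Y₀ y := fun x y => finProdFinEquiv.symm.injective.eq_iff
    have hent : ∀ U, labelEntropy p (fun e => (Yp e, joinLabel X U e)) =
        labelEntropy p (fun e => (Y₀ e, joinLabel X U e)) := fun U =>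
      labelEntropy_congr _ _ fun x y => by simp only [Prod.mk.injEq, hYp]
    obtain ⟨σ, h1, h2⟩ := exists_perm_both hp s X Yp (fun i => lam * Real.log (d i)) lam
      (fun U hU => (hbd U hU).1) (fun U hU => by
        rw [hent, Fintype.card_fin, Fintype.card_fin, ← mul_add,
          ← Real.log_mul (by exact_mod_cast hd0.ne') (by exact_mod_cast hdj.ne'), ← Nat.cast_mul]
        exact (hbd U hU).2)
    simp only [Fintype.card_fin] at h1 h2
    let X' : ι → E → ℕ := fun i e => if i = j then ((σ (Yp e)).2 : ℕ) else X i e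
    have hX'j : ∀ e, X' j e = (σ (Yp e)).2 := fun e => by simp [X']
    have hX's : ∀ i, i ≠ j → X' i = X i := fun i hi => by funext e; simp [X', hi]
    have hjoin : ∀ U, j ∉ U → joinLabel X' U = joinLabel X U := by
      intro U hjU
      funext e i
      by_cases hi : i ∈ U
      · rw [joinLabel, joinLabel, hX's i fun h => hjU (h ▸ hi)]
      · simp [joinLabel, hi]
    have hjoin' : ∀ U, j ∈ U → ∀ x y, joinLabel X' U x = joinLabel X' U y ↔
        (σ (Yp x)).2 = (σ (Yp y)).2 ∧ joinLabel X (U.erase j) x = joinLabel X (U.erase j) y := by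
      intro U hjU x y
      rw [joinLabel_eq_iff, joinLabel_eq_iff]
      constructor
      · intro h
        refine ⟨Fin.ext ?_, fun i hi => ?_⟩
        · have := h j hjU
          rwa [hX'j, hX'j] at this
        · rw [← hX's i (Finset.ne_of_mem_erase hi)]
          exact h i (Finset.mem_of_mem_erase hi)
      · rintro ⟨ha, hb⟩ i hi
        by_cases hij : i = j
        · rw [hij, hX'j, hX'j, ha]
        · rw [hX's i hij]
          exact hb i (Finset.mem_erase.2 ⟨hij, hi⟩)
    refine ⟨fun e => (σ (Yp e)).1, X', ?_, ?_, ?_⟩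
    · intro i hi e
      by_cases hij : i = j
      · rw [hij, hX'j]; exact Fin.is_lt _
      · rw [hX's i hij]; exact hXlt i ((Finset.mem_insert.1 hi).resolve_left hij) e
    · intro x y hY hX
      have hj' := hX j (Finset.mem_insert_self _ _)
      rw [hX'j, hX'j] at hj'
      have hYeq : Y₀ x = Y₀ y := (hYp x y).1 (σ.injective (Prod.ext hY (Fin.ext hj')))
      refine hinj x y hYeq fun i hi => ?_
      have hij : i ≠ j := fun h => hj (h ▸ hi)
      rw [← hX's i hij]
      exact hX i (Finset.mem_insert_of_mem hi)
    · intro U hU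
      by_cases hjU : j ∈ U
      · have hUs : U.erase j ⊆ s := by rwa [← Finset.subset_insert_iff]
        rw [← Finset.add_sum_erase U _ hjU]
        constructor
        · rw [labelEntropy_congr (joinLabel X' U)
            (fun e => ((σ (Yp e)).2, joinLabel X (U.erase j) e)) fun x y => by
              rw [hjoin' U hjU]; simp only [Prod.mk.injEq]]
          linarith [h2 _ hUs]
        · rw [labelEntropy_congr (fun e => ((σ (Yp e)).1, joinLabel X' U e))
            (fun e => (Y₀ e, joinLabel X (U.erase j) e)) fun x y => by
              simp only [Prod.mk.injEq]
              rw [hjoin' U hjU, ← hYp, ← σ.injective.eq_iff (a := Yp x),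
                Prod.ext_iff (x := σ (Yp x)), and_assoc]]
          have := (hbd _ hUs).2
          rw [Nat.cast_mul, Real.log_mul (by exact_mod_cast hd0.ne')
            (by exact_mod_cast hdj.ne')] at this
          linarith
      · have hUs : U ⊆ s := (Finset.subset_insert_iff_of_notMem hjU).1 hU
        simp only [hjoin U hjU]
        exact ⟨(hbd U hUs).1, h1 U hUs⟩

/-! ### Embeddings adapted to a system of coordinates -/

section Embedding

variable {α E : Type*} [Fintype α]

/-- The push-forward of `π` along `f`, as a function on the target. -/
noncomputable def pushMass {α E : Type*} [Fintype α] (π : α → ℝ) (f : α → E) (e : E) : ℝ := by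
  classical exact ∑ y, if f y = e then π y else 0

lemma pushMass_nonneg {π : α → ℝ} (hπ : ∀ y, 0 ≤ π y) (f : α → E) (e : E) :
    0 ≤ pushMass π f e := by
  classical
  exact Finset.sum_nonneg fun y _ => by split_ifs <;> simp [hπ]

variable [Fintype E]

lemma sum_pushMass_mul (π : α → ℝ) (f : α → E) (G : E → ℝ) :
    ∑ e, pushMass π f e * G e = ∑ y, π y * G (f y) := by
  classical
  simp only [pushMass, Finset.sum_mul]
  rw [Finset.sum_comm]
  refine Finset.sum_congr rfl fun y _ => ?_
  rw [Finset.sum_eq_single (f y)]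
  · simp
  · intro b _ hb
    rw [if_neg hb.symm, zero_mul]
  · simp

lemma sum_pushMass (π : α → ℝ) (f : α → E) : ∑ e, pushMass π f e = ∑ y, π y := by
  simpa using sum_pushMass_mul π f fun _ => 1

lemma fiberMass_pushMass {κ : Type*} (π : α → ℝ) (f : α → E) (g : E → κ) (y : α) :
    fiberMass (pushMass π f) g (f y) = fiberMass π (fun x => g (f x)) y := by
  classical
  have := sum_pushMass_mul π f fun e => if g e = g (f y) then 1 else 0
  simp only [mul_ite, mul_one, mul_zero] at this
  simpa only [fiberMass, Finset.sum_filter] using this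

lemma labelEntropy_pushMass {κ : Type*} (π : α → ℝ) (f : α → E) (g : E → κ) :
    labelEntropy (pushMass π f) g = labelEntropy π (fun x => g (f x)) := by
  rw [labelEntropy, labelEntropy, sum_pushMass_mul]
  simp only [fiberMass_pushMass]

/-- If the points of `E` are addressed by coordinates `C e i < d i` filling the whole box, then a
law `π` on `α` can be embedded in `E` in such a way that every set `T` of coordinates carries at
least its share `log (∏ i ∈ T, d i) / log |E|` of the entropy of `π`. -/
lemma exists_embedding_of_coordinates {ι : Type*} [DecidableEq ι] [Fintype ι] {π : α → ℝ}
    (hπ : ∀ y, 0 ≤ π y) (hπ1 : ∑ y, π y = 1) (hcard : Nat.card α ≤ Nat.card E)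
    (hE : 1 < Nat.card E) (d : ι → ℕ) (C : E → ι → ℕ) (hC : ∀ e i, C e i < d i)
    (hinj : Function.Injective C) (hd : ∏ i, d i = Nat.card E) :
    ∃ Φ : α ↪ E, ∀ T : Finset ι, (∑ i ∈ T, Real.log (d i)) * ∑ y, Real.negMulLog (π y) ≤
      Real.log (Nat.card E) * labelEntropy π (fun y => joinLabel (fun i e => C e i) T (Φ y)) := by
  classical
  rw [Nat.card_eq_fintype_card] at hE hd hcard ⊢
  rw [Nat.card_eq_fintype_card] at hcard
  obtain ⟨Φ₀⟩ := Function.Embedding.nonempty_of_card_le hcard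
  have hlog : 0 < Real.log (Fintype.card E) := Real.log_pos (by exact_mod_cast hE)
  have hH : ∑ e, Real.negMulLog (pushMass π Φ₀ e) = ∑ y, Real.negMulLog (π y) := by
    rw [← labelEntropy_of_injective (p := pushMass π Φ₀) id Function.injective_id,
      labelEntropy_pushMass]
    exact labelEntropy_of_injective _ Φ₀.injective
  obtain ⟨Y, X, hXlt, hXinj, hX⟩ := exists_arrangement (p := pushMass π Φ₀)
    (pushMass_nonneg hπ Φ₀) ((sum_pushMass π Φ₀).trans hπ1)
    ((∑ y, Real.negMulLog (π y)) / Real.log (Fintype.card E))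
    (by rw [hH, div_mul_cancel₀ _ hlog.ne']) d Finset.univ 1 (by rw [one_mul, hd])
  have hbij : Function.Bijective fun (e : E) (i : ι) => (⟨C e i, hC e i⟩ : Fin (d i)) := by
    rw [Fintype.bijective_iff_injective_and_card]
    refine ⟨fun e e' h => hinj (funext fun i => congrArg Fin.val (congrFun h i)), ?_⟩
    rw [Fintype.card_pi, ← hd]
    simp
  let β := Equiv.ofBijective _ hbij
  have hβ : ∀ (x : ∀ i, Fin (d i)) (i : ι), C (β.symm x) i = x i := fun x i =>
    congrArg Fin.val (congrFun (β.apply_symm_apply x) i)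
  let τ : E → ∀ i, Fin (d i) := fun e i => ⟨X i e, hXlt i (Finset.mem_univ i) e⟩
  have hτ : Function.Injective τ := fun e e' h =>
    hXinj e e' (Subsingleton.elim _ _) fun i _ => congrArg Fin.val (congrFun h i)
  refine ⟨⟨fun y => β.symm (τ (Φ₀ y)), fun y y' h => Φ₀.injective (hτ (β.symm.injective h))⟩, ?_⟩
  intro T
  have h := (hX T (Finset.subset_univ T)).1
  rw [labelEntropy_pushMass, ← Finset.mul_sum, div_mul_eq_mul_div, div_le_iff₀ hlog] at h
  rw [labelEntropy_congr _ (fun y => joinLabel X T (Φ₀ y))]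
  · linarith
  · intro y y'
    rw [joinLabel_eq_iff, joinLabel_eq_iff]
    change (∀ i ∈ T, C (β.symm (τ (Φ₀ y))) i = C (β.symm (τ (Φ₀ y'))) i) ↔ _
    simp only [hβ, τ]

end Embedding

/-! ### Rings all of whose left ideals are visible in coordinates -/

section Ideals

/-- Every left ideal of `S` is `0`, `J` or `S`. -/
def IdealsThrough {S : Type*} [Ring S] (J : Ideal S) : Prop :=
  ∀ I : Ideal S, I = ⊥ ∨ I = J ∨ I = ⊤

lemma IsField.idealsThrough_bot {S : Type*} [Ring S] (hS : IsField S) :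
    IdealsThrough (⊥ : Ideal S) := by
  intro I
  by_cases hI : I = ⊥
  · exact Or.inl hI
  · obtain ⟨x, hxI, hx⟩ := I.exists_mem_ne_zero_of_ne_bot hI
    obtain ⟨y, hy⟩ := hS.mul_inv_cancel hx
    rw [hS.mul_comm] at hy
    exact Or.inr (Or.inr ((Ideal.eq_top_iff_one I).2 (hy ▸ I.mul_mem_left y hxI)))

lemma HasUniqueSqrtIdeal.exists_idealsThrough {S : Type*} [Ring S] (hS : HasUniqueSqrtIdeal S) :
    ∃ J : Ideal S, IdealsThrough J := by
  obtain ⟨J, hJ, -⟩ := hS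
  refine ⟨J, fun I => ?_⟩
  by_contra! h
  exact h.2.1 ((hJ I).1 ⟨h.1, h.2.2⟩)

lemma isGoodProduct_of_factor {R : Type u} [Ring R] (h : IsField R ∨ HasUniqueSqrtIdeal R) :
    IsGoodProduct R :=
  ⟨1, fun _ => R, fun _ => inferInstance, fun _ => h,
    ⟨(RingEquiv.piUnique fun _ : Fin 1 => R).symm⟩⟩

variable {ι : Type*} [Fintype ι] [DecidableEq ι] {S : ι → Type*} [∀ i, Ring (S i)]

/-- A left ideal of a finite product of rings is a product of left ideals. -/
lemma Ideal.exists_mem_iff_forall_mem_of_pi (I : Ideal (∀ i, S i)) :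
    ∃ L : ∀ i, Ideal (S i), ∀ x, x ∈ I ↔ ∀ i, x i ∈ L i := by
  refine ⟨fun i =>
    { carrier := {s | Pi.single i s ∈ I}
      add_mem' := fun {a b} ha hb => by
        simp only [Set.mem_ofPred_eq] at ha hb ⊢
        rw [Pi.single_add]; exact I.add_mem ha hb
      zero_mem' := by simp
      smul_mem' := fun c a ha => by
        simp only [Set.mem_ofPred_eq] at ha ⊢
        rw [smul_eq_mul, Pi.single_mul]; exact I.mul_mem_left _ ha }, fun x => ?_⟩
  change x ∈ I ↔ ∀ i, Pi.single i (x i) ∈ I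
  constructor
  · intro hx i
    have : Pi.single i (x i) = Pi.single i 1 * x := by rw [← Pi.single_mul_left, one_mul]
    rw [this]
    exact I.mul_mem_left _ hx
  · intro h
    rw [← Finset.univ_sum_single x]
    exact I.sum_mem fun i _ => h i

/-- In a product of finite rings `S i` whose left ideals are `0`, `J i` and `S i`, the coordinates
in `S i / J i` and in `J i` (relative to fixed representatives of the cosets) describe every left
ideal: congruence modulo the ideal is equality of some of the coordinates. -/
lemma exists_coordinates_pi [∀ i, Finite (S i)] (J : ∀ i, Ideal (S i))
    (hJ : ∀ i, IdealsThrough (J i)) :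
    ∃ (d : ι × Bool → ℕ) (C : (∀ i, S i) → ι × Bool → ℕ), (∀ x k, C x k < d k) ∧
      Function.Injective C ∧ ∏ k, d k = Nat.card (∀ i, S i) ∧
      ∀ I : Ideal (∀ i, S i), ∃ T : Finset (ι × Bool), ∀ x y, x - y ∈ I ↔
        ∀ k ∈ T, C x k = C y k := by
  classical
  have : ∀ i, Finite (S i ⧸ J i) := fun i =>
    Finite.of_surjective _ (Submodule.Quotient.mk_surjective (J i))
  let q : ∀ i, S i → S i ⧸ J i := fun i => Submodule.Quotient.mk
  let rep : ∀ i, S i ⧸ J i → S i := fun i =>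
    Function.surjInv (Submodule.Quotient.mk_surjective (J i))
  have hrep : ∀ i z, q i (rep i z) = z := fun i =>
    Function.surjInv_eq (Submodule.Quotient.mk_surjective (J i))
  let off : ∀ i, S i → J i := fun i s => ⟨s - rep i (q i s),
    (Submodule.Quotient.eq (J i)).1 (hrep i (q i s)).symm⟩
  let d : ι × Bool → ℕ := fun k => if k.2 then Nat.card (J k.1) else Nat.card (S k.1 ⧸ J k.1)
  let C : (∀ i, S i) → ι × Bool → ℕ := fun x k =>
    if k.2 then (Finite.equivFin (J k.1) (off k.1 (x k.1)) : ℕ)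
    else (Finite.equivFin (S k.1 ⧸ J k.1) (q k.1 (x k.1)) : ℕ)
  have hCf : ∀ x y i, C x (i, false) = C y (i, false) ↔ q i (x i) = q i (y i) := by
    intro x y i
    simp only [C, Bool.false_eq_true, if_false, Fin.val_inj, EmbeddingLike.apply_eq_iff_eq]
  have hCt : ∀ x y i, C x (i, true) = C y (i, true) ↔ off i (x i) = off i (y i) := by
    intro x y i
    simp only [C, if_true, Fin.val_inj, EmbeddingLike.apply_eq_iff_eq]
  have hboth : ∀ x y i, C x (i, false) = C y (i, false) ∧ C x (i, true) = C y (i, true) ↔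
      x i = y i := by
    intro x y i
    rw [hCf, hCt]
    constructor
    · rintro ⟨h1, h2⟩
      have h3 := congrArg Subtype.val h2
      simp only [off, h1] at h3
      exact sub_left_injective h3
    · intro h; rw [h]; exact ⟨rfl, rfl⟩
  refine ⟨d, C, ?_, ?_, ?_, ?_⟩
  · rintro x ⟨i, b⟩
    cases b <;> simp only [C, d, Bool.false_eq_true, if_false, if_true] <;> exact Fin.is_lt _
  · intro x y h
    funext i
    exact (hboth x y i).1 ⟨congrFun h _, congrFun h _⟩
  · rw [Nat.card_pi, Fintype.prod_prod_type]
    refine Finset.prod_congr rfl fun i _ => ?_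
    rw [Fintype.prod_bool, (J i).card_eq_card_quotient_mul_card]
    simp [d]
  · intro I
    obtain ⟨L, hL⟩ := I.exists_mem_iff_forall_mem_of_pi
    refine ⟨Finset.univ.filter fun k => (k.2 = false ∧ L k.1 ≠ ⊤) ∨ L k.1 = ⊥, fun x y => ?_⟩
    rw [hL]
    simp only [Finset.mem_filter, Finset.mem_univ, true_and, Prod.forall, Pi.sub_apply]
    refine forall_congr' fun i => ?_
    rw [Bool.forall_bool]
    simp only [true_and, Bool.true_eq_false, false_and, false_or]
    by_cases hbot : L i = ⊥
    · rw [hbot, Ideal.mem_bot, sub_eq_zero, ← hboth]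
      simp
    · by_cases htop : L i = ⊤
      · rw [htop] at hbot ⊢
        simp [hbot]
      · have hLJ := ((hJ i (L i)).resolve_left hbot).resolve_right htop
        rw [hLJ] at hbot htop ⊢
        rw [hCf, Submodule.Quotient.eq]
        simp [hbot, htop]

/-- `exists_coordinates_pi`, transported to a ring isomorphic to such a product. -/
lemma IsGoodProduct.exists_coordinates {R : Type u} [Ring R] [Finite R] (hR : IsGoodProduct R) :
    ∃ (m : ℕ) (d : Fin m × Bool → ℕ) (C : R → Fin m × Bool → ℕ), (∀ x k, C x k < d k) ∧
      Function.Injective C ∧ ∏ k, d k = Nat.card R ∧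
      ∀ I : Ideal R, ∃ T : Finset (Fin m × Bool), ∀ x y, x - y ∈ I ↔ ∀ k ∈ T, C x k = C y k := by
  obtain ⟨m, S, _, hS, ⟨e⟩⟩ := hR
  have : Finite (∀ i, S i) := Finite.of_equiv R e.toEquiv
  have : ∀ i, Finite (S i) := fun i =>
    Finite.of_surjective (fun x : ∀ i, S i => x i) (Function.surjective_eval i)
  have hJ : ∀ i, ∃ J : Ideal (S i), IdealsThrough J := fun i =>
    (hS i).elim (fun h => ⟨⊥, h.idealsThrough_bot⟩) fun h => h.exists_idealsThrough
  choose J hJ using hJ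
  obtain ⟨d, C, h1, h2, h3, h4⟩ := exists_coordinates_pi J hJ
  refine ⟨m, d, fun x => C (e x), fun x => h1 _, h2.comp e.injective,
    h3.trans (Nat.card_congr e.symm.toEquiv), fun I => ?_⟩
  obtain ⟨T, hT⟩ := h4 (I.comap (e.symm : (∀ i, S i) →+* R))
  refine ⟨T, fun x y => ?_⟩
  rw [← hT, Ideal.mem_comap]
  simp

/-- For every law `π` that fits into the finite ring `R` of the given form there is one injection
under which, for all left ideals `I` at once, the cosets of `I` carry at least the share
`log |R / I| / log |R|` of the entropy of `π`. -/
lemma IsGoodProduct.exists_embedding {R : Type u} [Ring R] [Fintype R] [Nontrivial R]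
    (hR : IsGoodProduct R) {α : Type*} [Fintype α] {π : α → ℝ} (hπ : ∀ y, 0 ≤ π y)
    (hπ1 : ∑ y, π y = 1) (hcard : Nat.card α ≤ Nat.card R) :
    ∃ Φ : α ↪ R, ∀ I : Ideal R,
      (Real.log (Nat.card R) - Real.log (Nat.card I)) * ∑ y, Real.negMulLog (π y) ≤
        Real.log (Nat.card R) * labelEntropy π (cosetMap Φ I) := by
  classical
  obtain ⟨m, d, C, hC, hinj, hd, hI⟩ := hR.exists_coordinates
  obtain ⟨Φ, hΦ⟩ := exists_embedding_of_coordinates hπ hπ1 hcard Finite.one_lt_card d C hC hinj hd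
  refine ⟨Φ, fun I => ?_⟩
  obtain ⟨T, hT⟩ := hI I
  have hquot : ∀ x y : R, (Submodule.Quotient.mk x : R ⧸ I) = Submodule.Quotient.mk y ↔
      ∀ k ∈ T, C x k = C y k := fun x y => by rw [Submodule.Quotient.eq, hT]
  have hle : Nat.card (R ⧸ I) ≤ ∏ k ∈ T, d k := by
    obtain ⟨rep, hrep⟩ := (Submodule.Quotient.mk_surjective I).hasRightInverse
    have hinj : Function.Injective fun (z : R ⧸ I) (k : T) =>
        (⟨C (rep z) k, hC _ _⟩ : Fin (d k)) := by
      intro z z' h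
      rw [← hrep z, ← hrep z', hquot]
      exact fun k hk => congrArg Fin.val (congrFun h ⟨k, hk⟩)
    refine (Nat.card_le_card_of_injective _ hinj).trans (le_of_eq ?_)
    rw [Nat.card_pi, ← Finset.prod_coe_sort T d]
    simp
  have hpos : 0 < Nat.card I := Nat.card_pos
  have hposq : 0 < Nat.card (R ⧸ I) := Nat.card_pos
  have hdpos : ∀ k, d k ≠ 0 := fun k => (Nat.zero_lt_of_lt (hC 0 k)).ne'
  have hlog : Real.log (Nat.card R) - Real.log (Nat.card I) ≤ ∑ k ∈ T, Real.log (d k) := by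
    rw [I.card_eq_card_quotient_mul_card, Nat.cast_mul,
      Real.log_mul (by exact_mod_cast hpos.ne') (by exact_mod_cast hposq.ne'), add_sub_cancel_left,
      ← Real.log_prod (fun k _ => by exact_mod_cast hdpos k)]
    exact Real.log_le_log (by exact_mod_cast hposq) (by exact_mod_cast hle)
  have hH : 0 ≤ ∑ y, Real.negMulLog (π y) := Finset.sum_nonneg fun y _ =>
    Real.negMulLog_nonneg (hπ y)
      ((Finset.single_le_sum (fun y _ => hπ y) (Finset.mem_univ y)).trans hπ1.le)
  refine (mul_le_mul_of_nonneg_right hlog hH).trans ((hΦ T).trans (le_of_eq ?_))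
  rw [labelEntropy_congr _ (cosetMap Φ I)]
  intro y y'
  rw [joinLabel_eq_iff, cosetMap, cosetMap, hquot]

end Ideals

/-! ### Entropies of labels of a random point -/

lemma entropy_eq_sum_negMulLog {α : Type*} [Fintype α] (p : α → ℝ) :
    entropy p = (∑ a, Real.negMulLog (p a)) / Real.log 2 := by
  rw [entropy, Finset.sum_div]
  refine Finset.sum_congr rfl fun a _ => ?_
  rw [Real.logb, Real.negMulLog]
  ring

lemma entropy_pushMass {α κ : Type*} [Fintype α] [Fintype κ] (π : α → ℝ) (f : α → κ) :
    entropy (pushMass π f) = labelEntropy π f / Real.log 2 := by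
  rw [entropy_eq_sum_negMulLog, ← labelEntropy_of_injective (p := pushMass π f) id
    Function.injective_id, labelEntropy_pushMass]
  rfl

lemma cosetDist_eq_pushMass {α R : Type*} [Fintype α] [Ring R] (π : α → ℝ) (Φ : α ↪ R)
    (I : Ideal R) : cosetDist π Φ I = pushMass π (cosetMap Φ I) := by
  funext A
  simp only [cosetDist, pushMass]

/-! ### Product laws -/

section Product

variable {m : ℕ} {α : Type*} [Fintype α]

lemma sum_prod_mul_prod (s G : Fin m → α → ℝ) :
    ∑ z : Fin m → α, (∏ i, s i (z i)) * ∏ i, G i (z i) = ∏ i, ∑ a, s i a * G i a := by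
  rw [Finset.prod_univ_sum, Fintype.piFinset_univ]
  simp only [Finset.prod_mul_distrib]

lemma sum_prod_mul_apply (s : Fin m → α → ℝ) (hs : ∀ i, ∑ a, s i a = 1) (i : Fin m) (g : α → ℝ) :
    ∑ z : Fin m → α, (∏ j, s j (z j)) * g (z i) = ∑ a, s i a * g a := by
  have h := sum_prod_mul_prod s fun j a => if j = i then g a else 1
  simp only [Finset.prod_ite_eq', Finset.mem_univ, if_true] at h
  rw [h, Finset.prod_eq_single i]
  · simp
  · intro j _ hj
    simp [hj, hs]
  · simp

lemma entropy_prod (s : Fin m → α → ℝ) (hs : ∀ i, ∑ a, s i a = 1) :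
    entropy (fun z : Fin m → α => ∏ i, s i (z i)) = ∑ i, entropy (s i) := by
  have hlog : ∀ z : Fin m → α, -((∏ i, s i (z i)) * Real.logb 2 (∏ i, s i (z i))) =
      ∑ i, (∏ j, s j (z j)) * -Real.logb 2 (s i (z i)) := by
    intro z
    by_cases h : ∃ i, s i (z i) = 0
    · obtain ⟨i, hi⟩ := h
      rw [Finset.prod_eq_zero (Finset.mem_univ i) hi]
      simp
    · push Not at h
      rw [Real.logb_prod _ _ fun i _ => h i, Finset.mul_sum, ← Finset.sum_neg_distrib]
      simp only [mul_neg]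
  rw [entropy, Finset.sum_congr rfl fun z _ => hlog z, Finset.sum_comm]
  refine Finset.sum_congr rfl fun i _ => ?_
  rw [sum_prod_mul_apply s hs i fun a => -Real.logb 2 (s i a), entropy]
  simp only [mul_neg]

end Product

/-! ### The law of the source -/

lemma IrreducibleChain.pos {α : Type*} [Fintype α] {P : Matrix α α ℝ} {π : α → ℝ}
    (hP : IrreducibleChain P) (hrows : ∀ i j, P i j = π j) (hπ : ∀ j, 0 ≤ π j)
    (hπ1 : ∑ j, π j = 1) (j : α) : 0 < π j := by
  refine (hπ j).lt_of_ne fun h0 => hP ⟨{j}ᶜ, ?_, ?_, ?_⟩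
  · by_contra hempty
    rw [Set.not_nonempty_iff_eq_empty, Set.compl_empty_iff] at hempty
    have hall : ∀ i, π i = 0 := fun i => by
      have : i ∈ ({j} : Set α) := hempty ▸ Set.mem_univ i
      rw [Set.mem_singleton_iff.1 this, ← h0]
    simp [hall] at hπ1
  · intro h
    exact (h ▸ Set.mem_univ j : j ∈ ({j}ᶜ : Set α)) rfl
  · intro i _ k hk
    rw [hrows, Set.mem_singleton_iff.1 (not_not.1 hk), ← h0]

section Source

variable {Ω α : Type*} [MeasurableSpace Ω] {μ : Measure Ω} {X : ℕ → Ω → α} {P : Matrix α α ℝ}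
  {π : α → ℝ}

/-- The marginal laws of the source: arbitrary at time `0`, and `π` at all later times. -/
def marginal (μ : Measure Ω) (X : ℕ → Ω → α) (π : α → ℝ) (n : ℕ) (a : α) : ℝ :=
  if n = 0 then μ.real {ω | X 0 ω = a} else π a

variable [MeasurableSpace α]

lemma measurable_block (hX : IsMarkovChain μ X P) (m : ℕ) :
    Measurable fun ω (i : Fin m) => X i ω :=
  measurable_pi_lambda _ fun i => hX.measurable i

variable [IsProbabilityMeasure μ]

/-- The symbols of the source are independent. -/
lemma measureReal_block (hrows : ∀ i j, P i j = π j) (hX : IsMarkovChain μ X P)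
    (m : ℕ) (x : Fin m → α) :
    μ.real {ω | (fun i : Fin m => X i ω) = x} = ∏ i : Fin m, marginal μ X π i (x i) := by
  have main : ∀ n (x : ℕ → α), μ.real {ω | ∀ i ≤ n, X i ω = x i} =
      ∏ i ∈ Finset.range (n + 1), marginal μ X π i (x i) := by
    intro n x
    induction n with
    | zero => simp [marginal]
    | succ n ih =>
      rw [hX.markov, ih, hrows, Finset.prod_range_succ _ (n + 1), marginal]
      simp
  cases m with
  | zero =>
    simp [Subsingleton.elim _ x]
  | succ n =>
    have h := main n fun i => if hi : i < n + 1 then x ⟨i, hi⟩ else x 0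
    rw [Finset.prod_range] at h
    simp only [Fin.is_lt, dif_pos, Fin.eta] at h
    rw [← h]
    congr 1
    ext ω
    simp only [Set.mem_ofPred_eq, funext_iff]
    constructor
    · intro h i hi
      rw [dif_pos (by omega)]
      exact h ⟨i, by omega⟩
    · intro h i
      have := h i (by omega)
      rwa [dif_pos i.is_lt] at this

lemma measureReal_preimage_eq_sum {β : Type*} [Fintype β] [MeasurableSpace β]
    [MeasurableSingletonClass β] {T : Ω → β} (hT : Measurable T) (p : β → Prop)
    [DecidablePred p] :
    μ.real {ω | p (T ω)} = ∑ b, if p b then μ.real {ω | T ω = b} else 0 := by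
  rw [← Finset.sum_filter, ← measureReal_biUnion_finset]
  · congr 1
    ext ω
    simp
  · intro b _ b' _ hbb'
    refine Set.disjoint_left.2 fun ω h h' => hbb' ?_
    rw [← (h : T ω = b), ← (h' : T ω = b')]
  · exact fun b _ => hT (measurableSet_singleton b)

variable [Fintype α] [MeasurableSingletonClass α]

lemma sum_marginal (hπ1 : ∑ j, π j = 1) (hX : IsMarkovChain μ X P) (n : ℕ) :
    ∑ a, marginal μ X π n a = 1 := by
  simp only [marginal]
  split_ifs
  · have := measureReal_preimage_eq_sum (μ := μ) (hX.measurable 0) fun _ => True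
    simpa using this.symm
  · exact hπ1

lemma measureReal_block_label (hrows : ∀ i j, P i j = π j) (hX : IsMarkovChain μ X P) {κ : Type*}
    (f : α → κ) (m : ℕ) (z : Fin m → κ) :
    μ.real {ω | ∀ i : Fin m, f (X i ω) = z i} =
      ∏ i : Fin m, pushMass (marginal μ X π i) f (z i) := by
  classical
  rw [measureReal_preimage_eq_sum (measurable_block hX m) fun x => ∀ i : Fin m, f (x i) = z i]
  have h := sum_prod_mul_prod (fun (i : Fin m) (a : α) => marginal μ X π i a)
    fun i a => if f a = z i then 1 else 0
  simp only [mul_ite, mul_one, mul_zero] at h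
  simp only [pushMass]
  rw [← h]
  refine Finset.sum_congr rfl fun x _ => ?_
  rw [measureReal_block hrows hX]
  by_cases hx : ∀ i, f (x i) = z i
  · rw [if_pos hx]
    simp [hx]
  · rw [if_neg hx]
    push Not at hx
    obtain ⟨i, hi⟩ := hx
    exact (mul_eq_zero_of_right _ (Finset.prod_eq_zero (Finset.mem_univ i) (if_neg hi))).symm

/-- The entropy rate of a function of the source is the entropy of a single symbol: the first symbol
does not matter in the limit. -/
lemma tendsto_blockEntropy (hrows : ∀ i j, P i j = π j) (hπ1 : ∑ j, π j = 1)
    (hX : IsMarkovChain μ X P) {κ : Type*} [Fintype κ] (f : α → κ) :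
    Tendsto (blockEntropy μ (fun n ω => f (X n ω))) atTop (𝓝 (entropy (pushMass π f))) := by
  rw [← tendsto_add_atTop_iff_nat 1]
  have h : ∀ n : ℕ, blockEntropy μ (fun n ω => f (X n ω)) (n + 1) = entropy (pushMass π f) +
      (entropy (pushMass (marginal μ X π 0) f) - entropy (pushMass π f)) *
        (1 / ((n : ℝ) + 1)) := by
    intro n
    rw [blockEntropy]
    simp only [measureReal_block_label hrows hX]
    rw [entropy_prod _ fun i => (sum_pushMass _ f).trans (sum_marginal hπ1 hX i), Fin.sum_univ_succ]
    have : ∀ i : Fin n, marginal μ X π (i.succ : ℕ) = π := fun i => by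
      funext a; simp [marginal]
    simp only [this, Finset.sum_const, Finset.card_univ, Fintype.card_fin, nsmul_eq_mul,
      Fin.val_zero]
    push_cast
    field_simp
    ring
  simp only [h]
  simpa using tendsto_const_nhds.add
    ((tendsto_one_div_add_atTop_nhds_zero_nat (𝕜 := ℝ)).const_mul
      (entropy (pushMass (marginal μ X π 0) f) - entropy (pushMass π f)))

end Source

/-! ### Stochastic complements of a matrix with equal rows -/

section Complement

variable {α : Type*} [Fintype α] {P : Matrix α α ℝ} {π : α → ℝ}

open Classical in
/-- Watching an independent sequence only while it is in `A` gives an independent sequence whose law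
is the conditional law on `A`. -/
lemma stochComplement_apply (hrows : ∀ i j, P i j = π j) (hπ : ∀ j, 0 < π j)
    (hπ1 : ∑ j, π j = 1) (A : Set α) (i j : A) :
    stochComplement P A i j = π j / ∑ y with y ∈ A, π y := by
  set a := ∑ y with y ∈ A, π y with ha
  have ha0 : 0 < a := Finset.sum_pos (fun y _ => hπ y) ⟨i, by simp⟩
  have hb : ∑ y : (Aᶜ : Set α), π y = 1 - a := by
    rw [← hπ1, ← Finset.sum_filter_add_sum_filter_not Finset.univ (· ∈ A), ← ha,
      add_sub_cancel_left]
    refine (Finset.sum_subtype _ (fun x => ?_) π).symm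
    simp
  set Q : Matrix (Aᶜ : Set α) (Aᶜ : Set α) ℝ := P.submatrix (fun i => (i : α)) (fun j => (j : α))
    with hQ
  have hinv : (1 - Q)⁻¹ = 1 + a⁻¹ • Q := by
    have hQQ : Q * Q = (1 - a) • Q := by
      ext k l
      simp only [hQ, Matrix.mul_apply, Matrix.submatrix_apply, hrows, Matrix.smul_apply,
        smul_eq_mul, ← Finset.sum_mul, hb]
    refine Matrix.inv_eq_right_inv ?_
    rw [sub_mul, one_mul, mul_add, mul_one, Matrix.mul_smul, hQQ, smul_smul]
    have : (1 : ℝ) = a⁻¹ - a⁻¹ * (1 - a) := by field_simp; ring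
    have h2 : Q = a⁻¹ • Q - (a⁻¹ * (1 - a)) • Q := by
      rw [← sub_smul, ← this, one_smul]
    nth_rewrite 2 [h2]
    abel
  have hS : stochComplement P A i j = π j + (∑ l : (Aᶜ : Set α),
      (∑ k : (Aᶜ : Set α), π k * ((1 : Matrix (Aᶜ : Set α) (Aᶜ : Set α) ℝ) k l + a⁻¹ * π l))
        * π j) := by
    rw [stochComplement]
    simp only [Matrix.add_apply, Matrix.mul_apply, Matrix.submatrix_apply, hrows]
    congr 1
    refine Finset.sum_congr rfl fun l _ => ?_
    congr 1
    refine Finset.sum_congr rfl fun k _ => ?_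
    congr 1
    have : (1 - Q)⁻¹ k l = (1 : Matrix (Aᶜ : Set α) (Aᶜ : Set α) ℝ) k l + a⁻¹ * π l := by
      rw [hinv]; simp [hQ, hrows]
    convert this
  rw [hS]
  have h1 : ∀ l : (Aᶜ : Set α), ∑ k : (Aᶜ : Set α),
      π k * ((1 : Matrix (Aᶜ : Set α) (Aᶜ : Set α) ℝ) k l + a⁻¹ * π l) = a⁻¹ * π l := by
    intro l
    simp only [mul_add, Finset.sum_add_distrib, ← Finset.sum_mul, hb, Matrix.one_apply, mul_ite,
      mul_one, mul_zero, Finset.sum_ite_eq', Finset.mem_univ, if_true]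
    field_simp
    ring
  simp only [h1, ← Finset.sum_mul, ← Finset.mul_sum, hb]
  field_simp
  ring

lemma condEntropy_diagStochComplement (hrows : ∀ i j, P i j = π j) (hπ : ∀ j, 0 < π j)
    (hπ1 : ∑ j, π j = 1) {κ : Type*} (f : α → κ) :
    condEntropy (diagStochComplement P f) π = entropy π - labelEntropy π f / Real.log 2 := by
  classical
  have hm : ∀ i, 0 < fiberMass π f i := fun i =>
    (hπ i).trans_le (le_fiberMass (fun j => (hπ j).le) f i)
  have hS : ∀ i j, diagStochComplement P f i j =
      if f j = f i then π j / fiberMass π f i else 0 := by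
    intro i j
    rw [diagStochComplement]
    split_ifs with h
    · rw [stochComplement_apply hrows hπ hπ1]
      simp [fiberMass]
    · rfl
  have hterm : ∀ i j, π i * -(diagStochComplement P f i j *
      Real.logb 2 (diagStochComplement P f i j)) =
      (if f i = f j then π i else 0) * ((fiberMass π f j)⁻¹ *
        -(π j * Real.logb 2 (π j / fiberMass π f j))) := by
    intro i j
    rw [hS]
    by_cases h : f j = f i
    · rw [if_pos h, if_pos h.symm, show fiberMass π f j = fiberMass π f i by simp [fiberMass, h]]
      ring
    · rw [if_neg h, if_neg fun h' => h h'.symm]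
      simp
  simp only [condEntropy, entropy, Finset.mul_sum, hterm]
  rw [Finset.sum_comm, labelEntropy, Finset.sum_div, ← Finset.sum_sub_distrib]
  refine Finset.sum_congr rfl fun j _ => ?_
  rw [← Finset.sum_mul, ← Finset.sum_filter, ← mul_assoc]
  change fiberMass π f j * _ * _ = _
  rw [mul_inv_cancel₀ (hm j).ne', one_mul, Real.logb_div (hπ j).ne' (hm j).ne', Real.logb,
    Real.logb]
  ring

lemma condEntropy_of_rows (hrows : ∀ i j, P i j = π j) (hπ1 : ∑ j, π j = 1) :
    condEntropy P π = entropy π := by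
  have : ∀ i, P i = π := fun i => funext (hrows i)
  simp only [condEntropy, this, ← Finset.sum_mul, hπ1, one_mul]

end Complement

/-- Both terms of the minimum in the threshold are `H(π) - H(π_{Φ, I})`. -/
lemma markovThreshold_eq {Ω α R : Type*} [MeasurableSpace Ω] {μ : Measure Ω}
    [IsProbabilityMeasure μ] [Fintype α] [MeasurableSpace α] [MeasurableSingletonClass α] [Ring R]
    [Fintype R] {X : ℕ → Ω → α} {P : Matrix α α ℝ} {π : α → ℝ} (hrows : ∀ i j, P i j = π j)
    (hπ : ∀ j, 0 < π j) (hπ1 : ∑ j, π j = 1) (hX : IsMarkovChain μ X P) (Φ : α ↪ R) :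
    markovThreshold μ X P π Φ = ⨆ I : {I : Ideal R // I ≠ ⊥},
      Real.log (Nat.card R) / Real.log (Nat.card I.1) *
        (entropy π - entropy (cosetDist π Φ I.1)) := by
  rw [markovThreshold]
  congr 1
  funext I
  rw [entropyRate, (tendsto_blockEntropy hrows hπ1 hX (cosetMap Φ I.1)).limUnder_eq,
    condEntropy_of_rows hrows hπ1, condEntropy_diagStochComplement hrows hπ hπ1,
    cosetDist_eq_pushMass, entropy_pushMass, min_self]

/-! ### Random linear maps over a finite ring -/

section RandomMatrix

variable {R : Type*} [Ring R] {n : ℕ}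

/-- A random matrix kills a fixed vector `d` with probability `|I|⁻ᵏ`, where `I` is the left ideal
generated by the entries of `d`. -/
lemma card_mulVec_eq_zero (k : ℕ) (d : Fin n → R) :
    Nat.card {A : Matrix (Fin k) (Fin n) R // A.mulVec d = 0} *
      Nat.card (Ideal.span (Set.range d)) ^ k = Nat.card (Matrix (Fin k) (Fin n) R) := by
  let φ : (Fin n → R) →ₗ[R] R :=
    { toFun := fun v => v ⬝ᵥ d
      map_add' := fun v w => add_dotProduct v w d
      map_smul' := fun c v => smul_dotProduct c v d }
  have hrange : LinearMap.range φ = Ideal.span (Set.range d) := by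
    refine le_antisymm ?_ (Ideal.span_le.2 ?_)
    · rintro _ ⟨v, rfl⟩
      change ∑ i, v i * d i ∈ Ideal.span (Set.range d)
      exact sum_mem fun i _ =>
        Ideal.mul_mem_left _ (v i) (Ideal.subset_span (Set.mem_range_self i))
    · rintro _ ⟨i, rfl⟩
      exact ⟨Pi.single i 1, by simp [φ]⟩
  have hker : Nat.card (LinearMap.ker φ) * Nat.card (Ideal.span (Set.range d)) =
      Nat.card (Fin n → R) := by
    rw [← hrange, (LinearMap.ker φ).card_eq_card_quotient_mul_card,
      Nat.card_congr φ.quotKerEquivRange.toEquiv]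
  have hsub : Nat.card {A : Matrix (Fin k) (Fin n) R // A.mulVec d = 0} =
      Nat.card (LinearMap.ker φ) ^ k := by
    have e : {A : Matrix (Fin k) (Fin n) R // A.mulVec d = 0} ≃ (Fin k → LinearMap.ker φ) :=
      (Equiv.subtypeEquivRight fun A => funext_iff).trans
        (Equiv.subtypePiEquivPi (p := fun (_ : Fin k) (v : Fin n → R) => v ∈ LinearMap.ker φ))
    rw [Nat.card_congr e, Nat.card_fun, Nat.card_eq_fintype_card (α := Fin k),
      Fintype.card_fin]
  have hM : Nat.card (Matrix (Fin k) (Fin n) R) = Nat.card (Fin n → R) ^ k := by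
    rw [Matrix, Nat.card_fun (α := Fin k), Nat.card_eq_fintype_card (α := Fin k), Fintype.card_fin]
  rw [hsub, hM, ← hker, mul_pow]

open Classical in
/-- Random coding: some matrix has, on average over `q`, few collisions with the code book `T`.
Words that collide with `x` under many matrices differ from `x` by elements of a small left ideal,
so the words are counted according to the left ideal generated by the differences. -/
lemma exists_matrix_collisions_le [Fintype R] {α : Type*} [Fintype α] (k : ℕ) (Φ : α ↪ R)
    (T : Finset (Fin n → α)) (q : (Fin n → α) → ℝ) (hq : ∀ x, 0 ≤ q x) (hq1 : ∑ x, q x = 1)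
    (𝓘 : Finset (Ideal R)) (h𝓘 : ∀ I, I ≠ ⊥ → I ∈ 𝓘) (B : ℝ)
    (hB : ∀ x : Fin n → α, ∑ I ∈ 𝓘,
      ((T.filter fun x' => ∀ i, cosetMap Φ I (x' i) = cosetMap Φ I (x i)).card : ℝ) /
        (Nat.card I : ℝ) ^ k ≤ B) :
    ∃ A : Matrix (Fin k) (Fin n) R, ∑ x, q x * ((T.filter fun x' => x' ≠ x ∧
      A.mulVec (fun i => Φ (x' i)) = A.mulVec (fun i => Φ (x i))).card : ℝ) ≤ B := by
  let M : ℝ := Fintype.card (Matrix (Fin k) (Fin n) R)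
  have hM : 0 < M := by
    have : 0 < Fintype.card (Matrix (Fin k) (Fin n) R) := Fintype.card_pos
    simpa only [M, Nat.cast_pos] using this
  -- the number of matrices for which a fixed pair of words collides
  have hpair : ∀ x x' : Fin n → α, x' ≠ x →
      ((Finset.univ.filter fun A : Matrix (Fin k) (Fin n) R =>
        A.mulVec (fun i => Φ (x' i)) = A.mulVec (fun i => Φ (x i))).card : ℝ) ≤
      M * ∑ I ∈ 𝓘, if ∀ i, cosetMap Φ I (x' i) = cosetMap Φ I (x i) then
        ((Nat.card I : ℝ) ^ k)⁻¹ else 0 := by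
    intro x x' hne
    let d : Fin n → R := fun i => Φ (x' i) - Φ (x i)
    let I := Ideal.span (Set.range d)
    have hI : I ≠ ⊥ := by
      intro hbot
      refine hne (funext fun i => Φ.injective (sub_eq_zero.1 ?_))
      have : d i ∈ I := Ideal.subset_span (Set.mem_range_self i)
      rwa [hbot, Ideal.mem_bot] at this
    have hmem : ∀ i, cosetMap Φ I (x' i) = cosetMap Φ I (x i) := fun i =>
      (Submodule.Quotient.eq I).2 (Ideal.subset_span (Set.mem_range_self i))
    have hcount := card_mulVec_eq_zero k d
    have hpos : 0 < (Nat.card I : ℝ) ^ k := pow_pos (by exact_mod_cast Nat.card_pos) k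
    have hle : ((Nat.card I : ℝ) ^ k)⁻¹ ≤ ∑ I ∈ 𝓘,
        if ∀ i, cosetMap Φ I (x' i) = cosetMap Φ I (x i) then ((Nat.card I : ℝ) ^ k)⁻¹ else 0 := by
      refine le_trans ?_ (Finset.single_le_sum (fun J _ => ?_) (h𝓘 I hI))
      · rw [if_pos hmem]
      · split_ifs <;> positivity
    refine le_trans (le_of_eq ?_) (mul_le_mul_of_nonneg_left hle hM.le)
    rw [eq_mul_inv_iff_mul_eq₀ hpos.ne']
    have hset : (Finset.univ.filter fun A : Matrix (Fin k) (Fin n) R =>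
        A.mulVec (fun i => Φ (x' i)) = A.mulVec (fun i => Φ (x i))).card =
        Nat.card {A : Matrix (Fin k) (Fin n) R // A.mulVec d = 0} := by
      rw [Nat.card_eq_fintype_card, Fintype.card_subtype]
      congr 1
      refine Finset.filter_congr fun A _ => ?_
      rw [← sub_eq_zero, ← Matrix.mulVec_sub]
      rfl
    rw [Nat.card_eq_fintype_card (α := Matrix (Fin k) (Fin n) R)] at hcount
    rw [hset]
    simp only [M, ← hcount]
    push_cast
    rfl
  have hword : ∀ x : Fin n → α, ∑ A : Matrix (Fin k) (Fin n) R, ((T.filter fun x' => x' ≠ x ∧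
      A.mulVec (fun i => Φ (x' i)) = A.mulVec (fun i => Φ (x i))).card : ℝ) ≤ M * B := by
    intro x
    have hswap : ∑ A : Matrix (Fin k) (Fin n) R, ((T.filter fun x' => x' ≠ x ∧
        A.mulVec (fun i => Φ (x' i)) = A.mulVec (fun i => Φ (x i))).card : ℝ) =
        ∑ x' ∈ T.filter (· ≠ x), ((Finset.univ.filter fun A : Matrix (Fin k) (Fin n) R =>
          A.mulVec (fun i => Φ (x' i)) = A.mulVec (fun i => Φ (x i))).card : ℝ) := by
      simp only [Finset.card_filter, Nat.cast_sum, ← Finset.filter_filter]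
      rw [Finset.sum_comm]
    rw [hswap]
    calc _ ≤ ∑ x' ∈ T.filter (· ≠ x), M * ∑ I ∈ 𝓘,
          (if ∀ i, cosetMap Φ I (x' i) = cosetMap Φ I (x i) then
            ((Nat.card I : ℝ) ^ k)⁻¹ else 0) :=
          Finset.sum_le_sum fun x' hx' => hpair x x' (Finset.mem_filter.1 hx').2
      _ ≤ ∑ x' ∈ T, M * ∑ I ∈ 𝓘, (if ∀ i, cosetMap Φ I (x' i) = cosetMap Φ I (x i) then
            ((Nat.card I : ℝ) ^ k)⁻¹ else 0) := by
          refine Finset.sum_le_sum_of_subset_of_nonneg (Finset.filter_subset _ _) fun _ _ _ => ?_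
          refine mul_nonneg hM.le (Finset.sum_nonneg fun I _ => ?_)
          split_ifs <;> positivity
      _ = M * ∑ I ∈ 𝓘, ((T.filter fun x' =>
            ∀ i, cosetMap Φ I (x' i) = cosetMap Φ I (x i)).card : ℝ) / (Nat.card I : ℝ) ^ k := by
          rw [← Finset.mul_sum, Finset.sum_comm]
          congr 1
          refine Finset.sum_congr rfl fun I _ => ?_
          rw [← Finset.sum_filter, Finset.sum_const, nsmul_eq_mul, div_eq_mul_inv]
      _ ≤ M * B := mul_le_mul_of_nonneg_left (hB x) hM.le
  by_contra! hcon
  have h1 : M * B < ∑ A : Matrix (Fin k) (Fin n) R, ∑ x, q x * ((T.filter fun x' => x' ≠ x ∧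
      A.mulVec (fun i => Φ (x' i)) = A.mulVec (fun i => Φ (x i))).card : ℝ) := by
    have := Finset.sum_lt_sum_of_nonempty (s := (Finset.univ : Finset (Matrix (Fin k) (Fin n) R)))
      Finset.univ_nonempty fun A _ => hcon A
    rwa [Finset.sum_const, nsmul_eq_mul, Finset.card_univ] at this
  rw [Finset.sum_comm] at h1
  simp only [← Finset.mul_sum] at h1
  have h2 : ∑ x, q x * ∑ A : Matrix (Fin k) (Fin n) R, ((T.filter fun x' => x' ≠ x ∧
      A.mulVec (fun i => Φ (x' i)) = A.mulVec (fun i => Φ (x i))).card : ℝ) ≤ ∑ x, q x * (M * B) :=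
    Finset.sum_le_sum fun x _ => mul_le_mul_of_nonneg_left (hword x) (hq x)
  rw [← Finset.sum_mul, hq1, one_mul] at h2
  linarith

end RandomMatrix

/-! ### Typical words -/

section Typical

variable {n : ℕ} {α κ : Type*} [Fintype α] {π : α → ℝ}

open Classical in
/-- Among words agreeing with `x` after labelling by `f`, at most `exp c` have conditional
information at most `c`. -/
lemma card_filter_labels_le (hπ : ∀ a, 0 < π a) (f : α → κ) (c : ℝ) (T : Finset (Fin n → α))
    (hT : ∀ x ∈ T, ∑ i, Real.log (fiberMass π f (x i) / π (x i)) ≤ c) (x : Fin n → α) :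
    ((T.filter fun x' => ∀ i, f (x' i) = f (x i)).card : ℝ) ≤ Real.exp c := by
  have hm : ∀ a, 0 < fiberMass π f a := fun a =>
    (hπ a).trans_le (le_fiberMass (fun b => (hπ b).le) f a)
  have hw : ∀ x' ∈ T.filter (fun x' => ∀ i, f (x' i) = f (x i)), Real.exp (-c) ≤
      ∏ i, (if f (x' i) = f (x i) then π (x' i) / fiberMass π f (x' i) else 0) := by
    intro x' hx'
    obtain ⟨h1, h2⟩ := Finset.mem_filter.1 hx'
    simp only [h2, if_true]
    have : ∏ i, π (x' i) / fiberMass π f (x' i) =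
        Real.exp (-∑ i, Real.log (fiberMass π f (x' i) / π (x' i))) := by
      rw [← Finset.sum_neg_distrib, Real.exp_sum]
      refine Finset.prod_congr rfl fun i _ => ?_
      rw [← Real.log_inv, inv_div, Real.exp_log (div_pos (hπ _) (hm _))]
    rw [this]
    exact Real.exp_le_exp.2 (neg_le_neg (hT x' h1))
  have hsum : ∑ x' : Fin n → α,
      ∏ i, (if f (x' i) = f (x i) then π (x' i) / fiberMass π f (x' i) else 0) = 1 := by
    rw [← Fintype.piFinset_univ, ← Finset.prod_univ_sum (fun _ => Finset.univ)
      fun i a => if f a = f (x i) then π a / fiberMass π f a else 0]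
    refine Finset.prod_eq_one fun i _ => ?_
    rw [← div_self (hm (x i)).ne']
    conv_rhs => rw [fiberMass, Finset.sum_div]
    rw [← Finset.sum_filter]
    refine Finset.sum_congr (by ext; simp) fun a ha => ?_
    have : f a = f (x i) := (Finset.mem_filter.1 ha).2
    simp only [fiberMass, this]
  have h1 := Finset.card_nsmul_le_sum _ _ _ hw
  rw [nsmul_eq_mul] at h1
  have h2 : ∑ x' ∈ T.filter (fun x' => ∀ i, f (x' i) = f (x i)),
      ∏ i, (if f (x' i) = f (x i) then π (x' i) / fiberMass π f (x' i) else 0) ≤ 1 := by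
    rw [← hsum]
    refine Finset.sum_le_sum_of_subset_of_nonneg (Finset.subset_univ _) fun x' _ _ =>
      Finset.prod_nonneg fun i _ => ?_
    split_ifs
    · exact (div_pos (hπ _) (hm _)).le
    · exact le_rfl
  have h3 := h1.trans h2
  rwa [Real.exp_neg, ← div_eq_mul_inv, div_le_one (Real.exp_pos c)] at h3

/-- The variance of a sum over independent coordinates. -/
lemma sum_prod_mul_sq (hπ1 : ∑ a, π a = 1) (g : α → ℝ) (hg : ∑ a, π a * g a = 0) :
    ∑ z : Fin n → α, (∏ i, π (z i)) * (∑ i, g (z i)) ^ 2 = n * ∑ a, π a * g a ^ 2 := by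
  have hcov : ∀ i j : Fin n, ∑ z : Fin n → α, (∏ l, π (z l)) * (g (z i) * g (z j)) =
      if i = j then ∑ a, π a * g a ^ 2 else 0 := by
    intro i j
    split_ifs with hij
    · subst hij
      simp only [← sq]
      exact sum_prod_mul_apply (fun _ => π) (fun _ => hπ1) i fun a => g a ^ 2
    · have h := sum_prod_mul_prod (fun (_ : Fin n) => π)
        fun l a => (if l = i then g a else 1) * (if l = j then g a else 1)
      simp only [Finset.prod_mul_distrib, Finset.prod_ite_eq', Finset.mem_univ, if_true] at h
      rw [h]
      refine Finset.prod_eq_zero (Finset.mem_univ i) ?_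
      simp [hij, hg]
  have hexp : ∀ z : Fin n → α, (∏ i, π (z i)) * (∑ i, g (z i)) ^ 2 =
      ∑ i, ∑ j, (∏ l, π (z l)) * (g (z i) * g (z j)) := by
    intro z
    rw [sq, Finset.sum_mul_sum, Finset.mul_sum]
    simp only [Finset.mul_sum]
  simp only [hexp]
  rw [Finset.sum_comm]
  simp only [Finset.sum_comm (s := (Finset.univ : Finset (Fin n → α))), hcov]
  simp

open Classical in
/-- Chebyshev's inequality for a sum over independent coordinates. -/
lemma sum_prod_filter_le (hπ : ∀ a, 0 ≤ π a) (hπ1 : ∑ a, π a = 1) (g : α → ℝ) (δ : ℝ) (hδ : 0 < δ)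
    (hn : 0 < n) :
    ∑ z : Fin n → α with n * (∑ a, π a * g a + δ) < ∑ i, g (z i), ∏ i, π (z i) ≤
      (∑ a, π a * (g a - ∑ b, π b * g b) ^ 2) / δ ^ 2 * (1 / n) := by
  set h := ∑ b, π b * g b with hh
  have hn' : (0 : ℝ) < n := by exact_mod_cast hn
  have hvar := sum_prod_mul_sq (n := n) hπ1 (fun a => g a - h)
    (by simp only [mul_sub, Finset.sum_sub_distrib, ← Finset.sum_mul, hπ1, ← hh]; ring)
  have h1 : ∑ z : Fin n → α with n * (h + δ) < ∑ i, g (z i), (∏ i, π (z i)) * (n * δ) ^ 2 ≤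
      n * ∑ a, π a * (g a - h) ^ 2 := by
    rw [← hvar]
    refine (Finset.sum_le_sum fun z hz => ?_).trans
      (Finset.sum_le_sum_of_subset_of_nonneg (Finset.filter_subset _ _) fun z _ _ =>
        mul_nonneg (Finset.prod_nonneg fun i _ => hπ _) (sq_nonneg _))
    refine mul_le_mul_of_nonneg_left ?_ (Finset.prod_nonneg fun i _ => hπ _)
    have hz' := (Finset.mem_filter.1 hz).2
    refine pow_le_pow_left₀ (by positivity) ?_ 2
    simp only [Finset.sum_sub_distrib, Finset.sum_const, Finset.card_univ, Fintype.card_fin,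
      nsmul_eq_mul]
    linarith
  rw [← Finset.sum_mul] at h1
  rw [div_mul_div_comm, mul_one, le_div_iff₀ (by positivity)]
  have h2 : (∑ z : Fin n → α with n * (h + δ) < ∑ i, g (z i), ∏ i, π (z i)) * (δ ^ 2 * n) * n ≤
      (∑ a, π a * (g a - h) ^ 2) * n := by
    linarith
  exact le_of_mul_le_mul_right h2 hn'

end Typical

/-! ### Achievability -/

section Achievability

variable {α R : Type*} [Fintype α] [Ring R] [Fintype R] {π : α → ℝ}

lemma finite_ideal (R : Type*) [Ring R] [Finite R] : Finite (Ideal R) :=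
  Finite.of_injective (fun I : Ideal R => (I : Set R)) SetLike.coe_injective

lemma log_card_ideal_pos {I : Ideal R} (hI : I ≠ ⊥) : 0 < Real.log (Nat.card I) := by
  have : Nontrivial I := Submodule.nontrivial_iff_ne_bot.2 hI
  exact Real.log_pos (by exact_mod_cast Finite.one_lt_card)

lemma sum_mul_log_fiberMass_div {κ : Type*} (hπ : ∀ a, 0 < π a) (f : α → κ) :
    ∑ a, π a * Real.log (fiberMass π f a / π a) =
      ∑ a, Real.negMulLog (π a) - labelEntropy π f := by
  rw [labelEntropy, ← Finset.sum_sub_distrib]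
  refine Finset.sum_congr rfl fun a _ => ?_
  have hm : 0 < fiberMass π f a := (hπ a).trans_le (le_fiberMass (fun b => (hπ b).le) f a)
  rw [Real.log_div hm.ne' (hπ a).ne', Real.negMulLog]
  ring

lemma entropy_sub_entropy_cosetDist (hπ : ∀ a, 0 < π a) (Φ : α ↪ R) (I : Ideal R) :
    entropy π - entropy (cosetDist π Φ I) =
      (∑ a, π a * Real.log (fiberMass π (cosetMap Φ I) a / π a)) / Real.log 2 := by
  rw [sum_mul_log_fiberMass_div hπ, cosetDist_eq_pushMass, entropy_pushMass,
    entropy_eq_sum_negMulLog, sub_div]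

/-- Decoding to the word of `T` with the received image succeeds on every word of `T` that does not
collide with another one. -/
lemma exists_decoder {ι : Type*} [Nonempty ι] {σ : Type*} (E : ι → σ) (T : Set ι) :
    ∃ ψ : σ → ι, ∀ x ∈ T, (∀ x' ∈ T, x' ≠ x → E x' ≠ E x) → ψ (E x) = x := by
  classical
  refine ⟨fun s => if h : ∃ x ∈ T, E x = s then h.choose else Classical.arbitrary ι, ?_⟩
  intro x hx hcol
  have h : ∃ x' ∈ T, E x' = E x := ⟨x, hx, rfl⟩
  change (if h : ∃ x' ∈ T, E x' = E x then h.choose else Classical.arbitrary ι) = x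
  rw [dif_pos h]
  by_contra hne
  exact hcol _ h.choose_spec.1 hne h.choose_spec.2

/-- With `k = ⌊n r / log |R|⌋` parity checks, the number of words of conditional information
`n (h + δ)` is small against `|I| ^ k`. The factor `|R|` pays for the rounding of `k`. -/
lemma exp_div_card_pow_le {I : Ideal R} (hI : I ≠ ⊥) {n : ℕ} {r h δ : ℝ}
    (hr : (h + 2 * δ) * Real.log (Nat.card R) ≤ r * Real.log (Nat.card I))
    (hR : 0 < Real.log (Nat.card R)) :
    Real.exp (n * (h + δ)) / (Nat.card I : ℝ) ^ ⌊n * r / Real.log (Nat.card R)⌋₊ ≤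
      Nat.card R * Real.exp (-(n * δ)) := by
  set k := ⌊n * r / Real.log (Nat.card R)⌋₊
  have hIlog := log_card_ideal_pos hI
  have hIpos : (0 : ℝ) < Nat.card I := by exact_mod_cast Nat.card_pos
  have hIR : (Nat.card I : ℝ) ≤ Nat.card R := by
    exact_mod_cast Nat.card_le_card_of_injective _ (Subtype.val_injective (p := (· ∈ I)))
  have hk : n * r / Real.log (Nat.card R) < k + 1 := Nat.lt_floor_add_one _
  have h1 : n * (h + 2 * δ) ≤ (k + 1) * Real.log (Nat.card I) := by
    rw [div_lt_iff₀ hR] at hk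
    have h2 := mul_le_mul_of_nonneg_left hr (Nat.cast_nonneg (α := ℝ) n)
    have h3 := mul_le_mul_of_nonneg_right hk.le hIlog.le
    refine le_of_mul_le_mul_right ?_ hR
    linarith
  have h4 : Real.exp (n * (h + 2 * δ)) ≤ Nat.card R * (Nat.card I : ℝ) ^ k := by
    calc Real.exp (n * (h + 2 * δ)) ≤ Real.exp ((k + 1 : ℕ) * Real.log (Nat.card I)) :=
          Real.exp_le_exp.2 (by push_cast; exact h1)
      _ = Nat.card I * (Nat.card I : ℝ) ^ k := by
          rw [Real.exp_nat_mul, Real.exp_log hIpos, pow_succ, mul_comm]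
      _ ≤ _ := mul_le_mul_of_nonneg_right hIR (by positivity)
  rw [div_le_iff₀ (by positivity)]
  calc Real.exp (n * (h + δ)) = Real.exp (n * (h + 2 * δ)) * Real.exp (-(n * δ)) := by
        rw [← Real.exp_add]; congr 1; ring
    _ ≤ Nat.card R * (Nat.card I : ℝ) ^ k * Real.exp (-(n * δ)) :=
        mul_le_mul_of_nonneg_right h4 (Real.exp_pos _).le
    _ = _ := by ring

variable {Ω : Type*} [MeasurableSpace Ω] {μ : Measure Ω} [IsProbabilityMeasure μ]
  [MeasurableSpace α] {X : ℕ → Ω → α} {P : Matrix α α ℝ}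

/-- The arbitrary law of the first symbol costs at most a constant factor. -/
lemma exists_measureReal_block_le (hrows : ∀ i j, P i j = π j) (hπ : ∀ a, 0 < π a)
    (hX : IsMarkovChain μ X P) :
    ∃ c : ℝ, 0 ≤ c ∧ ∀ (n : ℕ) (x : Fin n → α), 0 < n →
      μ.real {ω | (fun i : Fin n => X i ω) = x} ≤ c * ∏ i, π (x i) := by
  have hc : ∀ a, 1 ≤ (∑ b, (π b)⁻¹) * π a := by
    intro a
    rw [← inv_mul_cancel₀ (hπ a).ne']
    exact mul_le_mul_of_nonneg_right (Finset.single_le_sum (f := fun b => (π b)⁻¹)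
      (fun b _ => (inv_pos.2 (hπ b)).le) (Finset.mem_univ a)) (hπ a).le
  refine ⟨∑ b, (π b)⁻¹, Finset.sum_nonneg fun b _ => (inv_pos.2 (hπ b)).le, fun n x hn => ?_⟩
  obtain ⟨m, rfl⟩ := Nat.exists_eq_succ_of_ne_zero hn.ne'
  rw [measureReal_block hrows hX, Fin.prod_univ_succ, Fin.prod_univ_succ, ← mul_assoc]
  have hsucc : ∏ i : Fin m, marginal μ X π (i.succ : ℕ) (x i.succ) = ∏ i : Fin m, π (x i.succ) :=
    Finset.prod_congr rfl fun i _ => by simp [marginal]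
  rw [hsucc]
  refine mul_le_mul_of_nonneg_right ?_ (Finset.prod_nonneg fun i _ => (hπ _).le)
  refine le_trans ?_ (hc (x 0))
  simp only [marginal, Fin.val_zero, if_true]
  exact measureReal_le_one

/-- Every rate above the threshold is achieved by random linear maps, decoding to the unique
matching word whose conditional information with respect to every left ideal is typical. -/
lemma linearlyAchievable_of_forall_lt [MeasurableSingletonClass α] [Nontrivial R]
    (hrows : ∀ i j, P i j = π j) (hπ : ∀ a, 0 < π a) (hπ1 : ∑ a, π a = 1)
    (hX : IsMarkovChain μ X P) (Φ : α ↪ R) (r : ℝ)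
    (hr : ∀ I : Ideal R, I ≠ ⊥ → Real.log (Nat.card R) / Real.log (Nat.card I) *
      (entropy π - entropy (cosetDist π Φ I)) < r) :
    LinearlyAchievable μ X Φ r := by
  classical
  intro ε hε
  have := finite_ideal R
  have := Fintype.ofFinite (Ideal R)
  have hlog2 : 0 < Real.log 2 := Real.log_pos one_lt_two
  have hR : 0 < Real.log (Nat.card R) := Real.log_pos (by exact_mod_cast Finite.one_lt_card)
  let g : Ideal R → α → ℝ := fun I a => Real.log (fiberMass π (cosetMap Φ I) a / π a)
  let h : Ideal R → ℝ := fun I => ∑ a, π a * g I a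
  have hh0 : ∀ I, 0 ≤ h I := fun I => Finset.sum_nonneg fun a _ =>
    mul_nonneg (hπ a).le (Real.log_nonneg
      ((one_le_div (hπ a)).2 (le_fiberMass (fun b => (hπ b).le) _ a)))
  have hlt : ∀ I, I ≠ ⊥ → h I * Real.log (Nat.card R) <
      r * Real.log 2 * Real.log (Nat.card I) := by
    intro I hI
    have h1 := hr I hI
    rw [entropy_sub_entropy_cosetDist hπ, div_mul_div_comm,
      div_lt_iff₀ (mul_pos (log_card_ideal_pos hI) hlog2)] at h1
    simp only [h, g]
    linarith
  -- one `δ` keeps half of the room for typicality and half for the union bound over collisions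
  obtain ⟨δ, hδr, hδ⟩ : ∃ δ : ℝ, (∀ I, I ≠ ⊥ → (h I + 2 * δ) * Real.log (Nat.card R) ≤
      r * Real.log 2 * Real.log (Nat.card I)) ∧ 0 < δ := by
    have hev : ∀ᶠ δ in 𝓝[>] (0 : ℝ), ∀ I, I ≠ ⊥ → (h I + 2 * δ) * Real.log (Nat.card R) ≤
        r * Real.log 2 * Real.log (Nat.card I) := by
      refine eventually_all.2 fun I => ?_
      by_cases hI : I = ⊥
      · exact Eventually.of_forall fun _ h => absurd hI h
      · have hc : Continuous fun δ : ℝ => (h I + 2 * δ) * Real.log (Nat.card R) := by fun_prop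
        have := (hc.tendsto 0).eventually_lt_const
          (show (h I + 2 * 0) * _ < _ by rw [mul_zero, add_zero]; exact hlt I hI)
        filter_upwards [nhdsWithin_le_nhds this] with δ hδ _ using hδ.le
    exact (hev.and self_mem_nhdsWithin).exists
  -- the ideal `⊤` has threshold `H(π)`, so `r` is not negative and the floor below is genuine
  have hr0 : 0 ≤ r := by
    have h1 := hδr ⊤ top_ne_bot
    have h2 : 0 ≤ (h ⊤ + 2 * δ) * Real.log (Nat.card R) :=
      mul_nonneg (add_nonneg (hh0 _) (by linarith)) hR.le
    exact nonneg_of_mul_nonneg_left (nonneg_of_mul_nonneg_left (h2.trans h1)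
      (log_card_ideal_pos top_ne_bot)) hlog2
  obtain ⟨c, hc0, hc⟩ := exists_measureReal_block_le hrows hπ hX
  let 𝓘 : Finset (Ideal R) := {I | I ≠ ⊥}
  let V : Ideal R → ℝ := fun I => (∑ a, π a * (g I a - h I) ^ 2) / δ ^ 2
  have hlim : Tendsto (fun n : ℕ => c * ∑ I ∈ 𝓘, V I * (1 / (n : ℝ)) +
      ∑ _I ∈ 𝓘, (Nat.card R : ℝ) * Real.exp (-(n * δ))) atTop (𝓝 0) := by
    have h1 : Tendsto (fun n : ℕ => 1 / (n : ℝ)) atTop (𝓝 0) := tendsto_one_div_atTop_nhds_zero_nat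
    have h2 : Tendsto (fun n : ℕ => Real.exp (-(n * δ))) atTop (𝓝 0) :=
      Real.tendsto_exp_neg_atTop_nhds_zero.comp
        (tendsto_natCast_atTop_atTop.atTop_mul_const hδ)
    have h3 := ((tendsto_finsetSum 𝓘 fun I _ => h1.const_mul (V I)).const_mul c).add
      (tendsto_finsetSum 𝓘 fun _ _ => h2.const_mul (Nat.card R : ℝ))
    simpa using h3
  obtain ⟨N₀, hN₀⟩ := eventually_atTop.1 (hlim.eventually_lt_const hε)
  refine ⟨N₀, fun n hn => ⟨⌊n * (r * Real.log 2) / Real.log (Nat.card R)⌋₊, ?_, ?_⟩⟩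
  · have := Nat.floor_le (a := n * (r * Real.log 2) / Real.log (Nat.card R)) (by positivity)
    rw [Real.logb, ← mul_div_assoc, div_le_iff₀ hlog2]
    rw [le_div_iff₀ hR] at this
    linarith
  have hn0 : 0 < n := by omega
  -- `T` is the code book: words whose conditional information given their cosets is typical
  let T : Finset (Fin n → α) := {x | ∀ I, I ≠ ⊥ → ∑ i, g I (x i) ≤ n * (h I + δ)}
  let q : (Fin n → α) → ℝ := fun x => μ.real {ω | (fun i : Fin n => X i ω) = x}
  have hq0 : ∀ x, 0 ≤ q x := fun x => measureReal_nonneg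
  have hq1 : ∑ x, q x = 1 := by
    have := measureReal_preimage_eq_sum (μ := μ) (measurable_block hX n) fun _ => True
    simpa [q] using this.symm
  obtain ⟨A, hA⟩ := exists_matrix_collisions_le
    ⌊n * (r * Real.log 2) / Real.log (Nat.card R)⌋₊ Φ T q hq0 hq1 𝓘 (by simp [𝓘])
    (∑ _I ∈ 𝓘, (Nat.card R : ℝ) * Real.exp (-(n * δ))) fun x => by
      refine Finset.sum_le_sum fun I hI => ?_
      have hI : I ≠ ⊥ := (Finset.mem_filter.1 hI).2
      refine le_trans (div_le_div_of_nonneg_right ?_ (by positivity))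
        (exp_div_card_pow_le hI (hδr I hI) hR)
      exact card_filter_labels_le hπ _ _ T (fun x hx => (Finset.mem_filter.1 hx).2 I hI) x
  have hne : Nonempty α := by
    by_contra hempty
    rw [not_nonempty_iff] at hempty
    simp at hπ1
  obtain ⟨ψ, hψ⟩ := exists_decoder (fun x : Fin n → α => A.mulVec fun i => Φ (x i)) (T : Set _)
  refine ⟨A, ψ, lt_of_le_of_lt ?_ (hN₀ n hn.le)⟩
  rw [measureReal_preimage_eq_sum (measurable_block hX n)
    fun x : Fin n → α => ψ (A.mulVec fun i => Φ (x i)) ≠ x]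
  -- the first summand of the limit bounds the mass outside `T`, the second the collisions in `T`
  have hatyp : ∑ x, (if x ∉ T then q x else 0) ≤ c * ∑ I ∈ 𝓘, V I * (1 / (n : ℝ)) := by
    have hbad : ∀ I, ∑ x : Fin n → α with n * (h I + δ) < ∑ i, g I (x i), ∏ i, π (x i) ≤
        V I * (1 / (n : ℝ)) := fun I =>
      sum_prod_filter_le (fun a => (hπ a).le) hπ1 (g I) δ hδ hn0
    refine le_trans ?_ (mul_le_mul_of_nonneg_left (Finset.sum_le_sum fun I _ => hbad I) hc0)
    simp only [Finset.sum_filter]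
    rw [Finset.sum_comm, Finset.mul_sum]
    refine Finset.sum_le_sum fun x _ => ?_
    have hnn : ∀ I ∈ 𝓘, 0 ≤ if n * (h I + δ) < ∑ i, g I (x i) then ∏ i, π (x i) else 0 := by
      intro I _
      split_ifs
      · exact Finset.prod_nonneg fun i _ => (hπ _).le
      · exact le_rfl
    by_cases hx : x ∈ T
    · rw [if_neg (not_not.2 hx)]
      exact mul_nonneg hc0 (Finset.sum_nonneg hnn)
    · rw [if_pos hx]
      have hx' : ¬ ∀ I, I ≠ ⊥ → ∑ i, g I (x i) ≤ n * (h I + δ) := fun hall =>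
        hx (Finset.mem_filter.2 ⟨Finset.mem_univ _, hall⟩)
      push Not at hx'
      obtain ⟨I, hI, hIx⟩ := hx'
      refine (hc n x hn0).trans (mul_le_mul_of_nonneg_left ?_ hc0)
      have := Finset.single_le_sum hnn (Finset.mem_filter.2 ⟨Finset.mem_univ I, hI⟩)
      rwa [if_pos hIx] at this
  refine le_trans ?_ (add_le_add hatyp hA)
  rw [← Finset.sum_add_distrib]
  refine Finset.sum_le_sum fun x _ => ?_
  change (if _ then q x else 0) ≤ _
  have hcard : 0 ≤ q x * ((T.filter fun x' => x' ≠ x ∧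
      A.mulVec (fun i => Φ (x' i)) = A.mulVec (fun i => Φ (x i))).card : ℝ) :=
    mul_nonneg (hq0 x) (Nat.cast_nonneg _)
  by_cases hxT : x ∈ T
  · rw [if_neg (not_not.2 hxT), zero_add]
    split_ifs with hbad
    · have : ∃ x' ∈ T, x' ≠ x ∧ A.mulVec (fun i => Φ (x' i)) = A.mulVec (fun i => Φ (x i)) := by
        by_contra! hno
        exact hbad (hψ x hxT hno)
      obtain ⟨x', hx', hcol⟩ := this
      refine le_mul_of_one_le_right (hq0 x) ?_
      exact_mod_cast Finset.card_pos.2 ⟨x', Finset.mem_filter.2 ⟨hx', hcol⟩⟩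
    · exact hcard
  · rw [if_pos hxT]
    split_ifs
    · linarith
    · linarith [hq0 x]

end Achievability

/-! ### The union of the regions -/

lemma entropy_cosetDist_of_eq_top {α R : Type*} [Fintype α] [Ring R] [Fintype R] {π : α → ℝ}
    (hπ1 : ∑ a, π a = 1) (Φ : α ↪ R) {I : Ideal R} (hI : I = ⊤) :
    entropy (cosetDist π Φ I) = 0 := by
  rw [cosetDist_eq_pushMass, entropy_pushMass, labelEntropy_const hπ1, zero_div]
  exact fun x y => (Submodule.Quotient.eq I).2 (hI ▸ Submodule.mem_top)

theorem mainTheorem9 {Ω : Type*} [MeasurableSpace Ω] (μ : Measure Ω) [IsProbabilityMeasure μ]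
    {α : Type*} [Fintype α] [MeasurableSpace α] [MeasurableSingletonClass α]
    {R : Type*} [Ring R] [Fintype R] [Nontrivial R]
    (hcard : Nat.card α ≤ Nat.card R)
    (X : ℕ → Ω → α) (P : Matrix α α ℝ) (π : α → ℝ)
    (hπ_nonneg : ∀ j, 0 ≤ π j) (hπ_sum : ∑ j, π j = 1)
    (hP_rows : ∀ i j, P i j = π j) (hP_irr : IrreducibleChain P)
    (hX : IsMarkovChain μ X P) :
    (∀ Φ : α ↪ R,
      (∀ I : Ideal R, ∃ l : ℝ,
        Tendsto (blockEntropy μ (fun n ω => cosetMap Φ I (X n ω))) atTop (𝓝 l)) ∧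
      markovRegion μ X P π Φ =
        {r : ℝ | r > ⨆ I : {I : Ideal R // I ≠ ⊥},
          Real.log (Nat.card R) / Real.log (Nat.card I.1) *
            (entropy π - entropy (cosetDist π Φ I.1))} ∧
      ∀ r ∈ markovRegion μ X P π Φ, LinearlyAchievable μ X Φ r) ∧
    (IsField R ∨ HasUniqueSqrtIdeal R ∨ IsGoodProduct R →
      ⋃ Φ : α ↪ R, markovRegion μ X P π Φ = {r : ℝ | r > entropy π}) := by
  have hπ := hP_irr.pos hP_rows hπ_nonneg hπ_sum
  have hthr := markovThreshold_eq (R := R) hP_rows hπ hπ_sum hX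
  have hfin := finite_ideal R
  have hle : ∀ (Φ : α ↪ R) (I : Ideal R), I ≠ ⊥ →
      Real.log (Nat.card R) / Real.log (Nat.card I) * (entropy π - entropy (cosetDist π Φ I)) ≤
        markovThreshold μ X P π Φ := fun Φ I hI => by
    rw [hthr]
    exact le_ciSup (f := fun I : {I : Ideal R // I ≠ ⊥} =>
      Real.log (Nat.card R) / Real.log (Nat.card I.1) *
        (entropy π - entropy (cosetDist π Φ I.1))) (Set.finite_range _).bddAbove ⟨I, hI⟩
  refine ⟨fun Φ => ⟨fun I => ⟨_, tendsto_blockEntropy hP_rows hπ_sum hX (cosetMap Φ I)⟩,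
    ?_, ?_⟩, ?_⟩
  · rw [markovRegion, hthr]
  · intro r hr
    exact linearlyAchievable_of_forall_lt hP_rows hπ hπ_sum hX Φ r fun I hI =>
      (hle Φ I hI).trans_lt hr
  · intro hR
    have hgood : IsGoodProduct R := by
      rcases hR with h | h | h
      · exact isGoodProduct_of_factor (Or.inl h)
      · exact isGoodProduct_of_factor (Or.inr h)
      · exact h
    have hlogR : 0 < Real.log (Nat.card R) := Real.log_pos (by exact_mod_cast Finite.one_lt_card)
    ext r
    simp only [Set.mem_iUnion, markovRegion, Set.mem_ofPred_eq]
    constructor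
    · rintro ⟨Φ, hr⟩
      have h := hle Φ ⊤ top_ne_bot
      rw [entropy_cosetDist_of_eq_top hπ_sum Φ rfl,
        Nat.card_congr (Submodule.topEquiv (R := R) (M := R)).toEquiv,
        div_self hlogR.ne', one_mul, sub_zero] at h
      exact h.trans_lt hr
    · intro hr
      obtain ⟨Φ, hΦ⟩ := hgood.exists_embedding hπ_nonneg hπ_sum hcard
      refine ⟨Φ, lt_of_le_of_lt ?_ hr⟩
      rw [hthr]
      have : Nonempty {I : Ideal R // I ≠ ⊥} := ⟨⟨⊤, top_ne_bot⟩⟩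
      refine ciSup_le fun I => ?_
      have hI := log_card_ideal_pos I.2
      have h := hΦ I.1
      rw [entropy_sub_entropy_cosetDist hπ, sum_mul_log_fiberMass_div hπ, entropy_eq_sum_negMulLog,
        ← mul_div_assoc]
      refine div_le_div_of_nonneg_right ?_ (Real.log_nonneg one_le_two)
      rw [div_mul_eq_mul_div, div_le_iff₀ hI]
      linarith
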